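/- Let $d\in\mathbb N$, let $1<q<\infty$, and let $\Omega\subset\mathbb R^d$ be a bounded open convex set. Assume (A0): the boundary $\partial\Omega$ is smooth (of class $C^\infty$) and coincides with the set of extreme points of $\overline\Omega$. Let $W_0^{1,q}(\Omega,\mathbb R^{d\times d})$ be the closure of $C_c^\infty(\Omega,\mathbb R^{d\times d})$ in the Sobolev space $W^{1,q}(\Omega,\mathbb R^{d\times d})$; for $\varphi\in W_0^{1,q}(\Omega,\mathbb R^{d\times d})$ let $\operatorname{div}\varphi:\Omega\to\mathbb R^d$ be the row-wise weak divergence, $(\operatorname{div}\varphi)_i=\sum_{j=1}^d\partial_j\varphi_{ij}$. Call a measurable map $T:\Omega\to\mathbb R^d$ non-degenerate if $\mathcal L^d(T^{-1}(N))=0$ for every $N\subset\mathbb R^d$ with $\mathcal L^d(N)=0$, where $\mathcal L^d$ is the Lebesgue measure. Then there exists a collection $\{\mathfrak Q_n\}_{n=1}^\infty$ of subsets of $W_0^{1,q}(\Omega,\mathbb R^{d\times d})$ satisfying Hypothesis (H2), that is: (i) for every $n\ge1$, the linear span of $\mathfrak Q_n$ is finite-dimensional, and $\mathfrak Q_n$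 is a non-empty closed convex subset of $W_0^{1,q}(\Omega,\mathbb R^{d\times d})$; (ii) for every $n\ge1$ and every $\varphi\in\mathfrak Q_n$, the map $\operatorname{div}\varphi$ is non-degenerate; (iii) $\bigcup_{n\ge1}\mathfrak Q_n$ is dense in $W_0^{1,q}(\Omega,\mathbb R^{d\times d})$; (iv) $\mathfrak Q_i\subset\mathfrak Q_j$ whenever $1\le i\le j$. -/

import Mathlib

open MeasureTheory Set
open scoped ENNReal ContDiff

/-- `ℝ^d` with its Euclidean norm. -/
abbrev Eucl (d : ℕ) : Type := EuclideanSpace ℝ (Fin d)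

/-- `ℝ^{d × d}` with its Euclidean (Frobenius) norm; the `(i, j)` entry of `A` is `A (i, j)`. -/
abbrev Mat (d : ℕ) : Type := EuclideanSpace ℝ (Fin d × Fin d)

/-- `φ` belongs to `C_c^∞(Ω; F)`: smooth, with compact support contained in `Ω`
(functions on `Ω` being extended by zero). -/
structure IsTestFun {d : ℕ} {F : Type*} [NormedAddCommGroup F] [NormedSpace ℝ F]
    (Ω : Set (Eucl d)) (φ : Eucl d → F) : Prop where
  smooth : ContDiff ℝ ∞ φ
  compact : HasCompactSupport φ
  support : tsupport φ ⊆ Ω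

/-- `G` is the weak (distributional) derivative of `u` on `Ω`:
`∫_Ω (∂_v η) u = - ∫_Ω η (G v)` for all scalar test functions `η` and all directions `v`. -/
def IsWeakDeriv {d : ℕ} {F : Type*} [NormedAddCommGroup F] [NormedSpace ℝ F]
    (Ω : Set (Eucl d)) (u : Eucl d → F) (G : Eucl d → Eucl d →L[ℝ] F) : Prop :=
  ∀ η : Eucl d → ℝ, IsTestFun Ω η → ∀ v : Eucl d,
    ∫ x in Ω, (fderiv ℝ η x v) • u x = - ∫ x in Ω, η x • G x v

theorem IsTestFun.integrable_fderiv_smul {d : ℕ} {F : Type*} [NormedAddCommGroup F]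
    [NormedSpace ℝ F] {Ω : Set (Eucl d)} {q : ℝ≥0∞} [hq : Fact (1 ≤ q)] {η : Eucl d → ℝ}
    (hη : IsTestFun Ω η) (v : Eucl d) (u : Lp F q (volume.restrict Ω)) :
    Integrable (fun x => (fderiv ℝ η x v) • u x) (volume.restrict Ω) := by
  have hu : LocallyIntegrable u (volume.restrict Ω) := (Lp.memLp u).locallyIntegrable hq.out
  refine hu.integrable_smul_left_of_hasCompactSupport ?_ ?_
  · exact (hη.smooth.continuous_fderiv (by simp)).clm_apply continuous_const
  · exact hη.compact.fderiv_apply ℝ v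

theorem IsTestFun.integrable_smul_apply {d : ℕ} {F : Type*} [NormedAddCommGroup F]
    [NormedSpace ℝ F] {Ω : Set (Eucl d)} {q : ℝ≥0∞} [hq : Fact (1 ≤ q)] {η : Eucl d → ℝ}
    (hη : IsTestFun Ω η) (v : Eucl d) (G : Lp (Eucl d →L[ℝ] F) q (volume.restrict Ω)) :
    Integrable (fun x => η x • G x v) (volume.restrict Ω) := by
  have hG : LocallyIntegrable G (volume.restrict Ω) := (Lp.memLp G).locallyIntegrable hq.out
  have h := hG.integrable_smul_left_of_hasCompactSupport hη.smooth.continuous hη.compact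
  exact (h.apply_continuousLinearMap v)

/-- The Sobolev space `W^{1,q}(Ω; F)`. An element is a pair `(u, G)` of (classes of) `L^q`
functions on `Ω` such that `G` is the weak derivative of `u`; on an open set `G` is determined
by `u`. The norm is `max (‖u‖_q, ‖G‖_q)`, which is equivalent to the other usual norms. -/
def SobolevW {d : ℕ} (F : Type*) [NormedAddCommGroup F] [NormedSpace ℝ F]
    (Ω : Set (Eucl d)) (q : ℝ≥0∞) [Fact (1 ≤ q)] :
    Submodule ℝ (Lp F q (volume.restrict Ω) × Lp (Eucl d →L[ℝ] F) q (volume.restrict Ω)) where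
  carrier := {w | IsWeakDeriv Ω w.1 w.2}
  zero_mem' := by
    intro η hη v
    have h1 : ∫ x in Ω, (fderiv ℝ η x v) • (0 : Lp F q (volume.restrict Ω)) x = 0 := by
      refine integral_eq_zero_of_ae ?_
      filter_upwards [Lp.coeFn_zero F q (volume.restrict Ω)] with x hx
      rw [hx]; simp
    have h2 : ∫ x in Ω, η x • (0 : Lp (Eucl d →L[ℝ] F) q (volume.restrict Ω)) x v = 0 := by
      refine integral_eq_zero_of_ae ?_
      filter_upwards [Lp.coeFn_zero (Eucl d →L[ℝ] F) q (volume.restrict Ω)] with x hx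
      rw [hx]; simp
    change ∫ x in Ω, (fderiv ℝ η x v) • (0 : Lp F q (volume.restrict Ω)) x =
      - ∫ x in Ω, η x • (0 : Lp (Eucl d →L[ℝ] F) q (volume.restrict Ω)) x v
    rw [h1, h2, neg_zero]
  add_mem' := by
    intro a b ha hb η hη v
    have h1 : ∫ x in Ω, (fderiv ℝ η x v) • (a.1 + b.1) x =
        ∫ x in Ω, (fderiv ℝ η x v) • a.1 x + (fderiv ℝ η x v) • b.1 x := by
      refine integral_congr_ae ?_
      filter_upwards [Lp.coeFn_add a.1 b.1] with x hx
      rw [hx]; simp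
    have h2 : ∫ x in Ω, η x • (a.2 + b.2) x v = ∫ x in Ω, η x • a.2 x v + η x • b.2 x v := by
      refine integral_congr_ae ?_
      filter_upwards [Lp.coeFn_add a.2 b.2] with x hx
      rw [hx]; simp
    change ∫ x in Ω, (fderiv ℝ η x v) • (a.1 + b.1) x = - ∫ x in Ω, η x • (a.2 + b.2) x v
    rw [h1, h2, integral_add (hη.integrable_fderiv_smul v _) (hη.integrable_fderiv_smul v _),
      integral_add (hη.integrable_smul_apply v _) (hη.integrable_smul_apply v _),
      ha η hη v, hb η hη v]
    abel
  smul_mem' := by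
    intro c a ha η hη v
    have h1 : ∫ x in Ω, (fderiv ℝ η x v) • (c • a.1) x =
        ∫ x in Ω, c • ((fderiv ℝ η x v) • a.1 x) := by
      refine integral_congr_ae ?_
      filter_upwards [Lp.coeFn_smul c a.1] with x hx
      rw [hx]; simp [smul_smul, mul_comm]
    have h2 : ∫ x in Ω, η x • (c • a.2) x v = ∫ x in Ω, c • (η x • a.2 x v) := by
      refine integral_congr_ae ?_
      filter_upwards [Lp.coeFn_smul c a.2] with x hx
      rw [hx]; simp [smul_smul, mul_comm]
    change ∫ x in Ω, (fderiv ℝ η x v) • (c • a.1) x = - ∫ x in Ω, η x • (c • a.2) x v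
    rw [h1, h2, integral_smul, integral_smul, ha η hη v, smul_neg]

/-- The elements of `W^{1,q}(Ω; F)` that are given by a function in `C_c^∞(Ω; F)`. -/
def testFunctions {d : ℕ} (F : Type*) [NormedAddCommGroup F] [NormedSpace ℝ F]
    (Ω : Set (Eucl d)) (q : ℝ≥0∞) [Fact (1 ≤ q)] : Submodule ℝ (SobolevW F Ω q) where
  carrier := {w | ∃ φ : Eucl d → F, IsTestFun Ω φ ∧ w.1.1 =ᵐ[volume.restrict Ω] φ}
  zero_mem' := by
    refine ⟨0, ⟨contDiff_const, HasCompactSupport.zero, ?_⟩, Lp.coeFn_zero F q _⟩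
    simp [tsupport]
  add_mem' := by
    rintro a b ⟨φ, hφ, ha⟩ ⟨ψ, hψ, hb⟩
    refine ⟨φ + ψ, ⟨hφ.smooth.add hψ.smooth, hφ.compact.add hψ.compact, ?_⟩, ?_⟩
    · exact (tsupport_add φ ψ).trans (union_subset hφ.support hψ.support)
    · exact (Lp.coeFn_add a.1.1 b.1.1).trans (ha.add hb)
  smul_mem' := by
    rintro c a ⟨φ, hφ, ha⟩
    have hs : tsupport (c • φ) ⊆ tsupport φ :=
      closure_mono (Function.support_const_smul_subset c φ)
    refine ⟨c • φ, ⟨hφ.smooth.const_smul c, ?_, hs.trans hφ.support⟩, ?_⟩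
    · exact hφ.compact.of_isClosed_subset (isClosed_tsupport _) hs
    · exact (Lp.coeFn_smul c a.1.1).trans (ha.const_smul c)

/-- `W_0^{1,q}(Ω; F)`: the closure of `C_c^∞(Ω; F)` in `W^{1,q}(Ω; F)`, with the norm of
`W^{1,q}(Ω; F)`. -/
def SobolevW₀ {d : ℕ} (F : Type*) [NormedAddCommGroup F] [NormedSpace ℝ F]
    (Ω : Set (Eucl d)) (q : ℝ≥0∞) [Fact (1 ≤ q)] : Type _ :=
  ((testFunctions F Ω q).topologicalClosure : Submodule ℝ (SobolevW F Ω q))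

noncomputable instance SobolevW₀.instNormedAddCommGroup {d : ℕ} (F : Type*)
    [NormedAddCommGroup F] [NormedSpace ℝ F] (Ω : Set (Eucl d)) (q : ℝ≥0∞) [Fact (1 ≤ q)] :
    NormedAddCommGroup (SobolevW₀ F Ω q) :=
  inferInstanceAs (NormedAddCommGroup (testFunctions F Ω q).topologicalClosure)

noncomputable instance SobolevW₀.instNormedSpace {d : ℕ} (F : Type*)
    [NormedAddCommGroup F] [NormedSpace ℝ F] (Ω : Set (Eucl d)) (q : ℝ≥0∞) [Fact (1 ≤ q)] :
    NormedSpace ℝ (SobolevW₀ F Ω q) :=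
  inferInstanceAs (NormedSpace ℝ (testFunctions F Ω q).topologicalClosure)

/-- The (representative of the) weak derivative of `φ ∈ W_0^{1,q}(Ω; F)`. -/
noncomputable def weakGrad {d : ℕ} {F : Type*} [NormedAddCommGroup F] [NormedSpace ℝ F]
    {Ω : Set (Eucl d)} {q : ℝ≥0∞} [Fact (1 ≤ q)] (φ : SobolevW₀ F Ω q) :
    Eucl d → Eucl d →L[ℝ] F :=
  (φ.1 : SobolevW F Ω q).1.2

/-- The row-wise divergence of a matrix field `φ ∈ W_0^{1,q}(Ω; ℝ^{d × d})`:
`(div φ)_i = ∑_j ∂_j φ_{ij}`. -/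
noncomputable def divergence {d : ℕ} {Ω : Set (Eucl d)} {q : ℝ≥0∞} [Fact (1 ≤ q)]
    (φ : SobolevW₀ (Mat d) Ω q) : Eucl d → Eucl d :=
  fun x => WithLp.toLp 2 (fun i => ∑ j, weakGrad φ x (EuclideanSpace.single j 1) (i, j))

/-- A map `T : Ω → ℝ^d` is non-degenerate if preimages of Lebesgue null sets are null.
(This does not change if `T` is modified on a null set.) -/
def Nondegenerate {d : ℕ} (Ω : Set (Eucl d)) (T : Eucl d → Eucl d) : Prop :=
  ∀ N : Set (Eucl d), volume N = 0 → volume (Ω ∩ T ⁻¹' N) = 0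

/-- The boundary of `Ω` is smooth: near each of its points, `Ω` is the set where a `C^∞`
function with non-vanishing differential is negative. -/
def HasSmoothBoundary {d : ℕ} (Ω : Set (Eucl d)) : Prop :=
  ∀ x ∈ frontier Ω, ∃ U : Set (Eucl d), IsOpen U ∧ x ∈ U ∧ ∃ ρ : Eucl d → ℝ,
    ContDiffOn ℝ ∞ ρ U ∧ (∀ y ∈ U, fderiv ℝ ρ y ≠ 0) ∧ Ω ∩ U = {y ∈ U | ρ y < 0}

/-- Assumption (A0): the boundary of `Ω` is smooth and coincides with the set of extreme points
of the closed convex set `closure Ω`. -/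
structure AssumptionA0 {d : ℕ} (Ω : Set (Eucl d)) : Prop where
  smooth : HasSmoothBoundary Ω
  extreme : frontier Ω = (closure Ω).extremePoints ℝ

/-- Hypothesis (H2) on a collection `(Q_n)_{n ≥ 1}` of subsets of `W_0^{1,q}(Ω; ℝ^{d × d})`. -/
structure HypothesisH2 {d : ℕ} (Ω : Set (Eucl d)) (q : ℝ≥0∞) [Fact (1 ≤ q)]
    (Q : ℕ+ → Set (SobolevW₀ (Mat d) Ω q)) : Prop where
  finiteDimensional_span : ∀ n, FiniteDimensional ℝ (Submodule.span ℝ (Q n))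
  nonempty : ∀ n, (Q n).Nonempty
  isClosed : ∀ n, IsClosed (Q n)
  convex : ∀ n, Convex ℝ (Q n)
  nondegenerate_div : ∀ n, ∀ φ ∈ Q n, Nondegenerate Ω (divergence φ)
  dense : Dense (⋃ n, Q n)
  mono : ∀ i j, i ≤ j → Q i ⊆ Q j

open Filter Topology

variable {d : ℕ} {F : Type*} [NormedAddCommGroup F] [NormedSpace ℝ F] {Ω : Set (Eucl d)}
  {q : ℝ≥0∞}

/-! Two ingredients make non-degeneracy survive convex combinations. The first is the subspace `V =
countableGrad` of fields whose gradient takes a.e. only countably many values. The second is one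
fixed field `ψ` whose divergence is a.e. `a y • (x - y)`, with `a y ≠ 0` and centres `y` in a
countable set. For `v ∈ V` and `c ≠ 0`, `div (v + c • ψ)` agrees a.e. at each point with one of
countably many similarities `x ↦ b + c * a y • (x - y)`, so preimages of null sets are null.

If `v k` is a dense sequence in `V`, put `Q n = span {v 0, …, v n} + [1/n, 1] • ψ`. This is closed,
being a finite-dimensional subspace plus a compact set; it increases with `n`, and the union is
dense because `v k + (1/n) • ψ` tends to `v k`.

The field `ψ` is a weighted sum of bumps `(r² - ‖x - y‖²)₊ • Id` over disjoint balls filling `Ω` up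
to a null set (`exists_piecewise_quadratic`).

Density of `V` (`dense_countableGrad`) needs no triangulation: a scalar test function `φ` is the
difference of the uniformly convex functions `φ + 2L‖x‖²` and `2L‖x‖²`, and each is replaced by the
maximum of its tangents over one fine net (`IsTestFun.exists_piecewise_affine_approx`). The result
is Lipschitz with compact support, hence in `W_0^{1,q}` by mollification
(`LipschitzWith.exists_sobolevW₀`). -/

/-! ### Weak derivatives and limits in `L^q`. -/

theorem continuous_integral_smul_Lp {α : Type*} [MeasurableSpace α] {μ : Measure α}
    [IsFiniteMeasure μ] [Fact (1 ≤ q)] {g : α → ℝ} (hg : AEStronglyMeasurable g μ) {C : ℝ}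
    (hC : ∀ x, ‖g x‖ ≤ C) : Continuous fun u : Lp F q μ => ∫ x, g x • u x ∂μ := by
  have hint : ∀ u : Lp F q μ, Integrable (fun x => g x • u x) μ := fun u =>
    ((Lp.memLp u).integrable Fact.out).bdd_smul C hg (Eventually.of_forall hC)
  let A : Lp F q μ →ₗ[ℝ] F :=
    { toFun := fun u => ∫ x, g x • u x ∂μ
      map_add' := fun u v => by
        rw [← integral_add (hint u) (hint v)]
        refine integral_congr_ae ?_
        filter_upwards [Lp.coeFn_add u v] with x hx
        rw [hx]; simp
      map_smul' := fun c u => by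
        rw [RingHom.id_apply, ← integral_smul]
        refine integral_congr_ae ?_
        filter_upwards [Lp.coeFn_smul c u] with x hx
        rw [hx]; exact smul_comm _ _ _ }
  -- Hölder factor for `L^q ⊆ L^1`. For `q = ⊤` the conventions `⊤.toReal = 0` and `1 / 0 = 0` give
  -- the correct exponent `1`.
  set M : ℝ≥0∞ := μ univ ^ (1 / (1 : ℝ≥0∞).toReal - 1 / q.toReal)
  have hM : M ≠ ⊤ := by
    refine ENNReal.rpow_ne_top_of_nonneg ?_ (measure_ne_top _ _)
    rcases eq_or_ne q ⊤ with rfl | hq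
    · simp
    · have : 1 ≤ q.toReal := by
        rw [← ENNReal.toReal_one]
        exact ENNReal.toReal_mono hq Fact.out
      simpa using inv_le_one_of_one_le₀ this
  refine (A.mkContinuous (C * M.toReal) fun u => ?_).continuous
  have h1 : ∫ x, ‖u x‖ ∂μ ≤ ‖u‖ * M.toReal := by
    rw [integral_norm_eq_lintegral_enorm (Lp.aestronglyMeasurable u), Lp.norm_def,
      ← ENNReal.toReal_mul]
    refine ENNReal.toReal_mono (ENNReal.mul_ne_top (Lp.eLpNorm_ne_top u) hM) ?_
    rw [← eLpNorm_one_eq_lintegral_enorm]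
    exact eLpNorm_le_eLpNorm_mul_rpow_measure_univ Fact.out (Lp.aestronglyMeasurable u)
  rcases isEmpty_or_nonempty α with hα | ⟨⟨x₀⟩⟩
  · have : A u = 0 := by
      change ∫ x, g x • u x ∂μ = 0
      simp [Measure.eq_zero_of_isEmpty μ]
    rw [this, norm_zero]
    have hM0 : ‖u‖ = 0 := by simp [Lp.norm_def, Measure.eq_zero_of_isEmpty μ]
    simp [hM0]
  have hC0 : 0 ≤ C := (norm_nonneg _).trans (hC x₀)
  calc ‖A u‖ ≤ ∫ x, C * ‖u x‖ ∂μ := by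
        refine norm_integral_le_of_norm_le
          (((Lp.memLp u).integrable Fact.out).norm.const_mul C) (Eventually.of_forall fun x => ?_)
        rw [norm_smul]
        exact mul_le_mul_of_nonneg_right (hC x) (norm_nonneg _)
    _ = C * ∫ x, ‖u x‖ ∂μ := integral_const_mul _ _
    _ ≤ C * (‖u‖ * M.toReal) := mul_le_mul_of_nonneg_left h1 hC0
    _ = C * M.toReal * ‖u‖ := by ring

/-- Each test function and direction imposes one equation between continuous maps of `(u, G)`. -/
theorem isClosed_sobolevW [IsFiniteMeasure (volume.restrict Ω)] [Fact (1 ≤ q)] :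
    IsClosed (SobolevW F Ω q : Set (Lp F q (volume.restrict Ω) ×
      Lp (Eucl d →L[ℝ] F) q (volume.restrict Ω))) := by
  have key : (SobolevW F Ω q : Set (Lp F q (volume.restrict Ω) ×
      Lp (Eucl d →L[ℝ] F) q (volume.restrict Ω))) =
      ⋂ (η : Eucl d → ℝ) (_ : IsTestFun Ω η) (v : Eucl d),
        {w | ∫ x in Ω, (fderiv ℝ η x v) • w.1 x = - (∫ x in Ω, η x • w.2 x v)} := by
    ext w
    simp only [mem_iInter]
    rfl
  rw [key]
  refine isClosed_iInter fun η => isClosed_iInter fun hη => isClosed_iInter fun v =>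
    isClosed_eq ?_ ?_
  · have hc : Continuous fun x => fderiv ℝ η x v :=
      (hη.smooth.continuous_fderiv (by simp)).clm_apply continuous_const
    obtain ⟨C, hC⟩ := (hη.compact.fderiv_apply ℝ v).exists_bound_of_continuous hc
    exact (continuous_integral_smul_Lp hc.aestronglyMeasurable hC).comp continuous_fst
  · obtain ⟨C, hC⟩ := hη.compact.exists_bound_of_continuous hη.smooth.continuous
    have h := (continuous_integral_smul_Lp (F := Eucl d →L[ℝ] F) (q := q)
      (μ := volume.restrict Ω) hη.smooth.continuous.aestronglyMeasurable hC).comp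
      (continuous_snd (X := Lp F q (volume.restrict Ω)))
    have h2 : ∀ G : Lp (Eucl d →L[ℝ] F) q (volume.restrict Ω),
        ∫ x in Ω, η x • G x v = (∫ x in Ω, η x • G x) v := fun G => by
      have hi : Integrable (fun x => η x • G x) (volume.restrict Ω) :=
        ((Lp.memLp G).integrable Fact.out).bdd_smul C
          hη.smooth.continuous.aestronglyMeasurable (Eventually.of_forall hC)
      exact (ContinuousLinearMap.integral_apply hi v).symm
    simp only [h2]
    exact ((ContinuousLinearMap.apply ℝ F v).continuous.comp h).neg

/-- The derivative of a test function is its weak derivative. -/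
theorem IsTestFun.isWeakDeriv {φ : Eucl d → F} (hφ : IsTestFun Ω φ) :
    IsWeakDeriv Ω φ (fderiv ℝ φ) := by
  intro η hη v
  have hηc : Continuous fun x => fderiv ℝ η x v :=
    (hη.smooth.continuous_fderiv (by simp)).clm_apply continuous_const
  have hφc : Continuous fun x => fderiv ℝ φ x v :=
    (hφ.smooth.continuous_fderiv (by simp)).clm_apply continuous_const
  have h := integral_smul_fderiv_eq_neg_fderiv_smul_of_integrable (μ := volume) (f := η) (g := φ)
    (v := v) ((hηc.smul hφ.smooth.continuous).integrable_of_hasCompactSupport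
      (hφ.compact.smul_left)) ((hη.smooth.continuous.smul hφc).integrable_of_hasCompactSupport
      (hη.compact.smul_right)) ((hη.smooth.continuous.smul
        hφ.smooth.continuous).integrable_of_hasCompactSupport hη.compact.smul_right)
    (fun x _ => hη.smooth.differentiable (by simp) x)
    (fun x _ => hφ.smooth.differentiable (by simp) x)
  have e1 : ∀ x, x ∉ Ω → fderiv ℝ η x v • φ x = 0 := fun x hx => by
    rw [image_eq_zero_of_notMem_tsupport fun h => hx (hφ.support h), smul_zero]
  have e2 : ∀ x, x ∉ Ω → η x • fderiv ℝ φ x v = 0 := fun x hx => by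
    rw [image_eq_zero_of_notMem_tsupport fun h => hx (hη.support h), zero_smul]
  rw [setIntegral_eq_integral_of_forall_compl_eq_zero e1,
    setIntegral_eq_integral_of_forall_compl_eq_zero e2, h, neg_neg]

theorem IsWeakDeriv.congr_left {u u' : Eucl d → F} {G : Eucl d → Eucl d →L[ℝ] F}
    (h : IsWeakDeriv Ω u G) (hu : u' =ᵐ[volume.restrict Ω] u) : IsWeakDeriv Ω u' G := by
  intro η hη v
  rw [← h η hη v]
  refine integral_congr_ae ?_
  filter_upwards [hu] with x hx
  rw [hx]

theorem IsWeakDeriv.congr_right {u : Eucl d → F} {G G' : Eucl d → Eucl d →L[ℝ] F}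
    (h : IsWeakDeriv Ω u G) (hG : G' =ᵐ[volume.restrict Ω] G) : IsWeakDeriv Ω u G' := by
  intro η hη v
  rw [h η hη v]
  congr 1
  refine integral_congr_ae ?_
  filter_upwards [hG] with x hx
  rw [hx]

/-- Weak derivatives on an open set are unique. -/
theorem IsWeakDeriv.ae_eq [CompleteSpace F] (hΩ : IsOpen Ω) {u : Eucl d → F}
    {G G' : Eucl d → Eucl d →L[ℝ] F}
    (h : IsWeakDeriv Ω u G) (h' : IsWeakDeriv Ω u G') (hG : IntegrableOn G Ω)
    (hG' : IntegrableOn G' Ω) : G =ᵐ[volume.restrict Ω] G' := by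
  have hd : IntegrableOn (fun x => G x - G' x) Ω := hG.sub hG'
  have key := hΩ.ae_eq_zero_of_integral_contDiff_smul_eq_zero (μ := volume)
    (hd.locallyIntegrableOn) (fun η h1 h2 h3 => ?_)
  · rw [EventuallyEq, ae_restrict_iff' hΩ.measurableSet]
    filter_upwards [key] with x hx hxΩ
    exact sub_eq_zero.1 (hx hxΩ)
  · have hη : IsTestFun Ω η := ⟨h1, h2, h3⟩
    obtain ⟨C, hC⟩ := h2.exists_bound_of_continuous h1.continuous
    have hi : ∀ {H : Eucl d → Eucl d →L[ℝ] F}, IntegrableOn H Ω →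
        IntegrableOn (fun x => η x • H x) Ω := fun hH =>
      Integrable.bdd_smul hH C h1.continuous.aestronglyMeasurable (Eventually.of_forall hC)
    rw [← setIntegral_eq_integral_of_forall_compl_eq_zero (s := Ω) (fun x hx => by
      rw [image_eq_zero_of_notMem_tsupport fun h => hx (h3 h), zero_smul])]
    simp only [smul_sub]
    rw [integral_sub (hi hG) (hi hG'), sub_eq_zero]
    ext1 v
    rw [ContinuousLinearMap.integral_apply (hi hG), ContinuousLinearMap.integral_apply (hi hG')]
    exact neg_injective ((h η hη v).symm.trans (h' η hη v))

/-- Bounded almost everywhere convergence on a finite measure space implies convergence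
in `L^q`. -/
theorem tendsto_toLp_of_forall_norm_le {α E : Type*} [MeasurableSpace α] {μ : Measure α}
    [IsFiniteMeasure μ] [NormedAddCommGroup E] [hq : Fact (1 ≤ q)] (hq_top : q ≠ ⊤)
    {f : ℕ → α → E} {g : α → E} {C : NNReal} (hf : ∀ n, MemLp (f n) q μ) (hg : MemLp g q μ)
    (hC : ∀ n x, ‖f n x‖ ≤ C) (hfg : ∀ᵐ x ∂μ, Tendsto (fun n => f n x) atTop (𝓝 (g x))) :
    Tendsto (fun n => (hf n).toLp (f n)) atTop (𝓝 (hg.toLp g)) := by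
  rw [Lp.tendsto_Lp_iff_tendsto_eLpNorm'']
  refine tendsto_Lp_finite_of_tendsto_ae hq.out hq_top (fun n => (hf n).1) hg
    -- Vitali's theorem; cutting at `C + 1`, strictly above the common bound, leaves an empty set.
    (unifIntegrable_of hq.out hq_top (fun n => (hf n).1) fun ε _ => ⟨C + 1, fun n => ?_⟩) hfg
  have : {x | C + 1 ≤ ‖f n x‖₊} = ∅ := by
    ext x
    simp only [mem_ofPred_eq, mem_empty_iff_false, iff_false, not_le]
    exact lt_of_le_of_lt (by exact_mod_cast hC n x) (lt_add_one C)
  simp [this]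

/-- Allows limits to be taken in the ambient product of `L^q` spaces: closedness of `SobolevW` puts
them back in the Sobolev space. -/
theorem exists_sobolevW₀_of_mem_closure [IsFiniteMeasure (volume.restrict Ω)] [Fact (1 ≤ q)]
    {w : Lp F q (volume.restrict Ω) × Lp (Eucl d →L[ℝ] F) q (volume.restrict Ω)}
    (hw : w ∈ closure (Subtype.val '' (testFunctions F Ω q : Set (SobolevW F Ω q)))) :
    ∃ W : SobolevW₀ F Ω q, (W.1 : SobolevW F Ω q).1 = w := by
  have h1 : w ∈ SobolevW F Ω q := by
    refine closure_minimal ?_ isClosed_sobolevW hw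
    rintro _ ⟨a, -, rfl⟩
    exact a.2
  exact ⟨⟨⟨w, h1⟩, closure_subtype.2 hw⟩, rfl⟩

instance [IsFiniteMeasure (volume.restrict Ω)] [Fact (1 ≤ q)] [CompleteSpace F] :
    CompleteSpace (SobolevW₀ F Ω q) := by
  have : CompleteSpace (SobolevW F Ω q) := isClosed_sobolevW.completeSpace_coe
  exact (Submodule.isClosed_topologicalClosure (testFunctions F Ω q)).completeSpace_coe

theorem IsTestFun.exists_bounds {φ : Eucl d → F} (hφ : IsTestFun Ω φ) :
    ∃ C : NNReal, (∀ x, ‖φ x‖ ≤ C) ∧ ∀ x, ‖fderiv ℝ φ x‖ ≤ C := by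
  obtain ⟨A, hA⟩ := hφ.compact.exists_bound_of_continuous hφ.smooth.continuous
  obtain ⟨B, hB⟩ := (hφ.compact.fderiv ℝ).exists_bound_of_continuous
    (hφ.smooth.continuous_fderiv (by simp))
  exact ⟨(max A B).toNNReal, fun x => (hA x).trans ((le_max_left A B).trans (Real.le_coe_toNNReal _)),
    fun x => (hB x).trans ((le_max_right A B).trans (Real.le_coe_toNNReal _))⟩

theorem IsTestFun.memLp [IsFiniteMeasure (volume.restrict Ω)] {φ : Eucl d → F}
    (hφ : IsTestFun Ω φ) : MemLp φ q (volume.restrict Ω) :=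
  let ⟨C, hC, _⟩ := hφ.exists_bounds
  MemLp.of_bound hφ.smooth.continuous.aestronglyMeasurable C (Eventually.of_forall hC)

theorem IsTestFun.memLp_fderiv [IsFiniteMeasure (volume.restrict Ω)] {φ : Eucl d → F}
    (hφ : IsTestFun Ω φ) : MemLp (fderiv ℝ φ) q (volume.restrict Ω) :=
  let ⟨C, _, hC⟩ := hφ.exists_bounds
  MemLp.of_bound (hφ.smooth.continuous_fderiv (by simp)).aestronglyMeasurable C
    (Eventually.of_forall hC)

theorem IsTestFun.mem_image_testFunctions [IsFiniteMeasure (volume.restrict Ω)] [Fact (1 ≤ q)]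
    {φ : Eucl d → F} (hφ : IsTestFun Ω φ) :
    (hφ.memLp.toLp φ, hφ.memLp_fderiv.toLp (fderiv ℝ φ)) ∈
      Subtype.val '' (testFunctions F Ω q : Set (SobolevW F Ω q)) :=
  ⟨⟨_, (hφ.isWeakDeriv.congr_left hφ.memLp.coeFn_toLp).congr_right
    hφ.memLp_fderiv.coeFn_toLp⟩, ⟨φ, hφ, hφ.memLp.coeFn_toLp⟩, rfl⟩

/-! ### Mollification of Lipschitz functions. -/

section Mollify

variable [FiniteDimensional ℝ F] {K : NNReal} {u : Eucl d → F}

theorem LipschitzWith.locallyIntegrable_fderiv (hu : LipschitzWith K u) :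
    LocallyIntegrable (fderiv ℝ u) (volume : Measure (Eucl d)) := by
  have : CompleteSpace F := FiniteDimensional.complete ℝ F
  borelize (Eucl d →L[ℝ] F)
  refine (memLp_top_of_bound (measurable_fderiv ℝ u).aestronglyMeasurable (K : ℝ)
    (Eventually.of_forall fun x => ?_)).locallyIntegrable le_top
  exact norm_fderiv_le_of_lipschitz ℝ hu

open ContinuousLinearMap Convolution in
/-- The derivative of a mollified Lipschitz function is the mollified derivative. -/
theorem LipschitzWith.hasFDerivAt_convolution (hu : LipschitzWith K u) {ρ : Eucl d → ℝ}
    (hρ : Continuous ρ) (hρc : HasCompactSupport ρ) (x : Eucl d) :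
    HasFDerivAt (ρ ⋆[lsmul ℝ ℝ, volume] u) ((ρ ⋆[lsmul ℝ ℝ, volume] fderiv ℝ u) x) x := by
  have hm : ∀ x : Eucl d, Continuous fun t => ρ t • u (x - t) := fun x =>
    hρ.smul (hu.continuous.comp (continuous_const.sub continuous_id))
  have hmp : MeasurePreserving (fun t : Eucl d => x - t) volume volume :=
    Measure.measurePreserving_sub_left volume x
  have : CompleteSpace F := FiniteDimensional.complete ℝ F
  borelize (Eucl d →L[ℝ] F)
  refine (hasFDerivAt_integral_of_dominated_loc_of_lip (μ := volume) (s := univ)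
    (F := fun x t => ρ t • u (x - t)) (F' := fun t => ρ t • fderiv ℝ u (x - t))
    -- No sign of `ρ` is needed: the Lipschitz condition uses the absolute value of this bound.
    (bound := fun t => K * ρ t) univ_mem
    (Eventually.of_forall fun x => (hm x).aestronglyMeasurable)
    ((hm x).integrable_of_hasCompactSupport hρc.smul_right) ?_ ?_ ?_ ?_).2
  · exact (hρ.measurable.smul ((measurable_fderiv ℝ u).comp
      (measurable_const.sub measurable_id))).aestronglyMeasurable
  · refine Eventually.of_forall fun t => LipschitzOnWith.of_dist_le_mul fun y _ z _ => ?_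
    rw [dist_eq_norm, ← smul_sub, norm_smul, Real.coe_nnabs, abs_mul, NNReal.abs_eq]
    have := hu.dist_le_mul (y - t) (z - t)
    rw [dist_eq_norm, dist_sub_right] at this
    calc ‖ρ t‖ * ‖u (y - t) - u (z - t)‖ ≤ ‖ρ t‖ * (K * dist y z) := by gcongr
      _ = K * |ρ t| * dist y z := by rw [Real.norm_eq_abs]; ring
  · exact (hρ.integrable_of_hasCompactSupport hρc).const_mul _
  -- Rademacher's theorem, transported by the measure-preserving map `t ↦ x - t`.
  · filter_upwards [hmp.quasiMeasurePreserving.ae (hu.ae_differentiableAt)] with t ht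
    have h := ht.hasFDerivAt.comp x ((hasFDerivAt_id x).sub_const t)
    exact (h.const_smul (ρ t))

open ContinuousLinearMap Convolution in
/-- A Lipschitz function with compact support in `Ω` belongs to `W_0^{1,q}(Ω; F)`. -/
theorem LipschitzWith.exists_sobolevW₀ [IsFiniteMeasure (volume.restrict Ω)] [Fact (1 ≤ q)]
    (hq_top : q ≠ ⊤) (hΩ : IsOpen Ω) (hu : LipschitzWith K u) (huc : HasCompactSupport u)
    (hus : tsupport u ⊆ Ω) :
    ∃ W : SobolevW₀ F Ω q, (W.1 : SobolevW F Ω q).1.1 =ᵐ[volume.restrict Ω] u ∧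
      weakGrad W =ᵐ[volume.restrict Ω] fderiv ℝ u := by
  have : CompleteSpace F := FiniteDimensional.complete ℝ F
  borelize (Eucl d →L[ℝ] F)
  obtain ⟨δ, hδ, hδΩ⟩ := huc.isCompact.exists_cthickening_subset_open hΩ hus
  -- Outer radii at most `δ` keep the supports inside `Ω`. The fixed ratio of the radii gives a.e.
  -- convergence even for the merely bounded derivative.
  let ρ : ℕ → ContDiffBump (0 : Eucl d) := fun n =>
    { rIn := δ / (n + 1) / 2
      rOut := δ / (n + 1)
      rIn_pos := by positivity
      rIn_lt_rOut := half_lt_self (by positivity) }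
  have hρδ : ∀ n, (ρ n).rOut ≤ δ := fun n => div_le_self hδ.le (by simp)
  have hρ0 : Tendsto (fun n => (ρ n).rOut) atTop (𝓝 0) :=
    tendsto_const_nhds.div_atTop (tendsto_atTop_add_const_right _ _ tendsto_natCast_atTop_atTop)
  have hρ2 : ∀ᶠ n in atTop, (ρ n).rOut ≤ 2 * (ρ n).rIn := Eventually.of_forall fun n => by
    change δ / (n + 1) ≤ 2 * (δ / (n + 1) / 2)
    linarith
  set φ : ℕ → Eucl d → F := fun n => (ρ n).normed volume ⋆[lsmul ℝ ℝ, volume] u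
  have hφ' : ∀ n x, fderiv ℝ (φ n) x =
      ((ρ n).normed volume ⋆[lsmul ℝ ℝ, volume] fderiv ℝ u) x := fun n x =>
    (hu.hasFDerivAt_convolution (ρ n).continuous_normed (ρ n).hasCompactSupport_normed x).fderiv
  have hsupp : ∀ n, tsupport (φ n) ⊆ Metric.cthickening δ (tsupport u) := fun n => by
    refine closure_minimal ((support_convolution_subset _).trans ?_) Metric.isClosed_cthickening
    rw [(ρ n).support_normed_eq]
    rintro _ ⟨a, ha, b, hb, rfl⟩
    refine Metric.mem_cthickening_of_dist_le _ b _ _ (subset_tsupport _ hb) ?_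
    rw [dist_eq_norm, add_sub_cancel_right, ← dist_zero_right]
    exact (Metric.mem_ball.1 ha).le.trans (hρδ n)
  have hφ : ∀ n, IsTestFun Ω (φ n) := fun n =>
    { smooth := (ρ n).hasCompactSupport_normed.contDiff_convolution_left _ (ρ n).contDiff_normed
        hu.continuous.locallyIntegrable
      compact := (huc.isCompact.cthickening).of_isClosed_subset (isClosed_tsupport _) (hsupp n)
      support := (hsupp n).trans hδΩ }
  have hbound : ∀ {E : Type _} [NormedAddCommGroup E] [NormedSpace ℝ E] (n : ℕ) (g : Eucl d → E)
      (C : NNReal), (∀ x, ‖g x‖ ≤ C) → ∀ x,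
      ‖((ρ n).normed volume ⋆[lsmul ℝ ℝ, volume] g) x‖ ≤ C := fun n g C hC x => by
    calc ‖((ρ n).normed volume ⋆[lsmul ℝ ℝ, volume] g) x‖
        ≤ ∫ t, (ρ n).normed volume t * C := by
          refine norm_integral_le_of_norm_le ((ρ n).integrable_normed.mul_const _)
            (Eventually.of_forall fun t => ?_)
          rw [lsmul_apply, norm_smul, Real.norm_of_nonneg ((ρ n).nonneg_normed t)]
          exact mul_le_mul_of_nonneg_left (hC _) ((ρ n).nonneg_normed t)
      _ = C := by rw [integral_mul_const, (ρ n).integral_normed, one_mul]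
  obtain ⟨A, hA⟩ := huc.exists_bound_of_continuous hu.continuous
  have hA' : ∀ x, ‖u x‖ ≤ A.toNNReal := fun x => (hA x).trans (Real.le_coe_toNNReal _)
  have hK : ∀ x, ‖fderiv ℝ u x‖ ≤ K := fun x => norm_fderiv_le_of_lipschitz ℝ hu
  have hu1 : MemLp u q (volume.restrict Ω) :=
    MemLp.of_bound hu.continuous.aestronglyMeasurable A (Eventually.of_forall hA)
  have hu2 : MemLp (fderiv ℝ u) q (volume.restrict Ω) :=
    MemLp.of_bound (measurable_fderiv ℝ u).aestronglyMeasurable K (Eventually.of_forall hK)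
  have h1 := tendsto_toLp_of_forall_norm_le hq_top (fun n => (hφ n).memLp) hu1
    (fun n => hbound n u _ hA') (ae_restrict_of_ae
      (ContDiffBump.ae_convolution_tendsto_right_of_locallyIntegrable hρ0 hρ2
        hu.continuous.locallyIntegrable))
  have h2 := tendsto_toLp_of_forall_norm_le hq_top (fun n => (hφ n).memLp_fderiv) hu2
    (fun n x => by rw [hφ']; exact hbound n _ _ hK x) (ae_restrict_of_ae (by
      simp only [hφ']
      exact ContDiffBump.ae_convolution_tendsto_right_of_locallyIntegrable hρ0 hρ2
        hu.locallyIntegrable_fderiv))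
  obtain ⟨W, hW⟩ := exists_sobolevW₀_of_mem_closure (mem_closure_of_tendsto (h1.prodMk_nhds h2)
    (Eventually.of_forall fun n => (hφ n).mem_image_testFunctions))
  refine ⟨W, ?_, ?_⟩
  · rw [hW]; exact hu1.coeFn_toLp
  · rw [weakGrad, hW]; exact hu2.coeFn_toLp

end Mollify

/-! ### Extension by zero. -/

section Indicator

variable {E H : Type*} [NormedAddCommGroup E] [NormedSpace ℝ E] [NormedAddCommGroup H]

/-- Otherwise `interior S` and the complement of `closure S` would disconnect the segment. -/
theorem exists_mem_segment_frontier {S : Set E} {x y : E} (hx : x ∈ S) (hy : y ∉ S) :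
    ∃ p ∈ segment ℝ x y, p ∈ frontier S := by
  by_contra! h
  have hc : IsPreconnected (segment ℝ x y) := (convex_segment x y).isPreconnected
  obtain ⟨p, -, hp1, hp2⟩ := hc (interior S) (closure S)ᶜ isOpen_interior
    isClosed_closure.isOpen_compl
    (fun p hp => by
      by_cases hpc : p ∈ closure S
      · exact Or.inl (by_contra fun hi => h p hp ⟨hpc, hi⟩)
      · exact Or.inr hpc)
    ⟨x, left_mem_segment ℝ x y, by_contra fun hi => h x (left_mem_segment ℝ x y)
      ⟨subset_closure hx, hi⟩⟩
    ⟨y, right_mem_segment ℝ x y, fun hyc => h y (right_mem_segment ℝ x y)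
      ⟨hyc, fun hi => hy (interior_subset hi)⟩⟩
  exact hp2 (subset_closure (interior_subset hp1))

/-- A Lipschitz function on the closure of a set, vanishing on the frontier, extends by zero to a
Lipschitz function. -/
theorem LipschitzOnWith.indicator_of_frontier {S : Set E} {K : NNReal} {v : E → H}
    (hv : LipschitzOnWith K v (closure S)) (h0 : ∀ p ∈ frontier S, v p = 0) :
    LipschitzWith K (S.indicator v) := by
  have key : ∀ x ∈ S, ∀ y ∉ S, dist (v x) 0 ≤ K * dist x y := fun x hx y hy => by
    obtain ⟨p, hp, hpf⟩ := exists_mem_segment_frontier hx hy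
    rw [← h0 p hpf]
    refine (hv.dist_le_mul x (subset_closure hx) p hpf.1).trans ?_
    gcongr
    linarith [dist_add_dist_of_mem_segment hp, dist_nonneg (x := p) (y := y)]
  refine LipschitzWith.of_dist_le_mul fun x y => ?_
  by_cases hx : x ∈ S <;> by_cases hy : y ∈ S
  · rw [indicator_of_mem hx, indicator_of_mem hy]
    exact hv.dist_le_mul x (subset_closure hx) y (subset_closure hy)
  · rw [indicator_of_mem hx, indicator_of_notMem hy]
    exact key x hx y hy
  · rw [indicator_of_notMem hx, indicator_of_mem hy, dist_comm, dist_comm x]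
    exact key y hy x hx
  · rw [indicator_of_notMem hx, indicator_of_notMem hy, dist_self]
    positivity

end Indicator

/-! ### Maxima of tangents to a uniformly convex function. -/

section TangentMax

variable {E : Type*} [NormedAddCommGroup E] [NormedSpace ℝ E]

/-- The maximum over `z ∈ Z` of the affine functions `x ↦ f z + G z (x - z)`. -/
noncomputable def tangentMax (f : E → ℝ) (G : E → E →L[ℝ] ℝ) (Z : Finset E) (hZ : Z.Nonempty)
    (x : E) : ℝ :=
  Z.sup' hZ fun z => f z + G z (x - z)

variable {f : E → ℝ} {G : E → E →L[ℝ] ℝ} {Z : Finset E} (hZ : Z.Nonempty)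

theorem le_tangentMax {z : E} (hz : z ∈ Z) (x : E) :
    f z + G z (x - z) ≤ tangentMax f G Z hZ x :=
  Finset.le_sup' (fun z => f z + G z (x - z)) hz

theorem exists_lipschitzWith_tangentMax : ∃ K, LipschitzWith K (tangentMax f G Z hZ) := by
  refine ⟨Z.sup fun z => ‖G z‖₊, ?_⟩
  have : tangentMax f G Z hZ = Z.sup' hZ fun z x => f z + G z (x - z) := by
    ext x
    rw [tangentMax, Finset.sup'_apply]
  rw [this]
  refine Finset.sup'_induction hZ _ (fun a ha b hb => (ha.max hb).weaken (max_self _).le) fun z hz => ?_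
  have h1 : LipschitzWith ‖G z‖₊ fun x => f z + G z (x - z) :=
    LipschitzWith.of_dist_le_mul fun x y => by
      rw [dist_add_left, dist_eq_norm, ← map_sub, sub_sub_sub_cancel_right, dist_eq_norm]
      exact (G z).le_opNorm _
  exact h1.weaken (Finset.le_sup (f := fun z => ‖G z‖₊) hz)

/-- If `f` is uniformly convex with quadratic upper bounds, then near a net the maximum of its
tangents is close to `f`, and it is attained only at nearby points. -/
theorem exists_tangentMax_eq {m M h : ℝ} (hm : 0 < m)
    (hl : ∀ y z, m * ‖y - z‖ ^ 2 ≤ f y - f z - G z (y - z))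
    (hM : ∀ y z, f y - f z - G z (y - z) ≤ M * ‖y - z‖ ^ 2) (hM0 : 0 ≤ M) {x : E}
    (hx : ∃ z ∈ Z, ‖x - z‖ ≤ h) :
    ∃ z ∈ Z, tangentMax f G Z hZ x = f z + G z (x - z) ∧ m * ‖x - z‖ ^ 2 ≤ M * h ^ 2 ∧
      |tangentMax f G Z hZ x - f x| ≤ M * h ^ 2 ∧
      (DifferentiableAt ℝ (tangentMax f G Z hZ) x →
        fderiv ℝ (tangentMax f G Z hZ) x = G z) := by
  obtain ⟨z, hz, hzx⟩ := Finset.exists_mem_eq_sup' hZ fun z => f z + G z (x - z)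
  change tangentMax f G Z hZ x = _ at hzx
  obtain ⟨z₀, hz₀, hxz₀⟩ := hx
  -- With `z` the maximizer and `z₀` the nearby net point: `f x - M h² ≤` tangent at `z₀` `≤`
  -- tangent at `z` `≤ f x - m ‖x - z‖²`. This gives both estimates.
  have h1 := le_tangentMax (f := f) (G := G) hZ hz₀ x
  have h2 : M * ‖x - z₀‖ ^ 2 ≤ M * h ^ 2 := by gcongr
  have h3 := hM x z₀
  have h4 := hl x z
  have h5 : 0 ≤ m * ‖x - z‖ ^ 2 := by positivity
  refine ⟨z, hz, hzx, by linarith, by rw [abs_le]; constructor <;> linarith, fun hd => ?_⟩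
  have hA : HasFDerivAt (fun y => f z + G z (y - z)) (G z) x :=
    ((G z).hasFDerivAt.comp x ((hasFDerivAt_id x).sub_const z)).const_add (f z)
  -- The maximum lies above the tangent at `z` and touches it at `x`, which forces equal
  -- derivatives.
  have hmin : IsLocalMin (fun y => tangentMax f G Z hZ y - (f z + G z (y - z))) x :=
    Eventually.of_forall fun y => by
      have := le_tangentMax (f := f) (G := G) hZ hz y
      linarith
  have := hmin.hasFDerivAt_eq_zero (hd.hasFDerivAt.sub hA)
  exact sub_eq_zero.1 this

end TangentMax

/-! ### Piecewise affine approximation of test functions. -/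

/-- Measures how much of `‖x‖²` must be added to make `φ` uniformly convex. The bound is the mean
value inequality for `φ` minus its tangent at `z`. -/
theorem IsTestFun.exists_quadratic_bound {φ : Eucl d → ℝ} (hφ : IsTestFun Ω φ) :
    ∃ L : ℝ, 0 < L ∧ (∀ x y, ‖fderiv ℝ φ x - fderiv ℝ φ y‖ ≤ L * ‖x - y‖) ∧
      ∀ y z, |φ y - φ z - fderiv ℝ φ z (y - z)| ≤ L * ‖y - z‖ ^ 2 := by
  obtain ⟨C, hC⟩ := ContDiff.lipschitzWith_of_hasCompactSupport (hφ.compact.fderiv ℝ)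
    (hφ.smooth.fderiv_right (m := ∞) (by simp)) (by simp)
  have hL : ∀ x y, ‖fderiv ℝ φ x - fderiv ℝ φ y‖ ≤ (C + 1 : ℝ) * ‖x - y‖ := fun x y => by
    have := hC.norm_sub_le x y
    nlinarith [norm_nonneg (x - y)]
  refine ⟨C + 1, by positivity, hL, fun y z => ?_⟩
  have := (convex_segment z y).norm_image_sub_le_of_norm_fderiv_le' (f := φ) (𝕜 := ℝ)
    (φ := fderiv ℝ φ z) (C := (C + 1 : ℝ) * ‖y - z‖)
    (fun x _ => hφ.smooth.differentiable (by simp) x) (fun x hx => by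
      refine (hL x z).trans ?_
      gcongr
      rw [← dist_eq_norm, ← dist_eq_norm, dist_comm x, dist_comm y]
      linarith [dist_add_dist_of_mem_segment hx, dist_nonneg (x := x) (y := y)])
    (left_mem_segment ℝ z y) (right_mem_segment ℝ z y)
  rw [← Real.norm_eq_abs]
  calc _ ≤ _ := this
    _ = _ := by ring

/-- A scalar test function can be approximated in `W^{1,∞}` by compactly supported Lipschitz
functions whose gradients take finitely many values. -/
theorem IsTestFun.exists_piecewise_affine_approx (hΩ : IsOpen Ω) (hΩb : Bornology.IsBounded Ω)
    {φ : Eucl d → ℝ} (hφ : IsTestFun Ω φ) {ε : ℝ} (hε : 0 < ε) :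
    ∃ (K : NNReal) (u : Eucl d → ℝ) (S : Set (Eucl d →L[ℝ] ℝ)), LipschitzWith K u ∧
      HasCompactSupport u ∧ tsupport u ⊆ Ω ∧ S.Finite ∧ (∀ x ∈ Ω, ‖u x - φ x‖ ≤ ε) ∧
      ∀ᵐ x ∂volume.restrict Ω, fderiv ℝ u x ∈ S ∧ ‖fderiv ℝ u x - fderiv ℝ φ x‖ ≤ ε := by
  obtain ⟨L, hL, hφL, hφQ⟩ := hφ.exists_quadratic_bound
  obtain ⟨δ, hδ, hδΩ⟩ := hφ.compact.isCompact.exists_cthickening_subset_open hΩ hφ.support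
  -- Maximizers will lie within `2h` of `x`. The two maxima err by `3Lh²` each; the gradients err by
  -- `2Lh + 8Lh + 8Lh = 18Lh`.
  obtain ⟨h, hh, hhδ, hh1, hh2⟩ : ∃ h : ℝ, 0 < h ∧ 2 * h ≤ δ ∧ 6 * L * h ^ 2 ≤ ε ∧
      18 * L * h ≤ ε := by
    have h1 : ∀ᶠ h in 𝓝[>] (0 : ℝ), 2 * h < δ :=
      ((continuous_const.mul continuous_id).continuousWithinAt.eventually_lt
        continuousWithinAt_const (by simpa using hδ))
    have h2 : ∀ᶠ h in 𝓝[>] (0 : ℝ), 6 * L * h ^ 2 < ε :=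
      ((continuous_const.mul (continuous_id.pow 2)).continuousWithinAt.eventually_lt
        continuousWithinAt_const (by simpa using hε))
    have h3 : ∀ᶠ h in 𝓝[>] (0 : ℝ), 18 * L * h < ε :=
      ((continuous_const.mul continuous_id).continuousWithinAt.eventually_lt
        continuousWithinAt_const (by simpa using hε))
    obtain ⟨h, ⟨⟨h1, h2⟩, h3⟩, h4⟩ := (((h1.and h2).and h3).and self_mem_nhdsWithin).exists
    exact ⟨h, h4, h1.le, h2.le, h3.le⟩
  obtain ⟨Z, hZ, hnet⟩ : ∃ Z : Finset (Eucl d), Z.Nonempty ∧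
      ∀ x ∈ closure Ω, ∃ z ∈ Z, ‖x - z‖ ≤ h := by
    obtain ⟨t, -, htf, ht⟩ := hΩb.isCompact_closure.finite_cover_balls hh
    refine ⟨insert 0 htf.toFinset, Finset.insert_nonempty _ _, fun x hx => ?_⟩
    obtain ⟨z, hz, hxz⟩ := mem_iUnion₂.1 (ht hx)
    refine ⟨z, Finset.mem_insert_of_mem (htf.mem_toFinset.2 hz), ?_⟩
    rw [← dist_eq_norm]
    exact (Metric.mem_ball.1 hxz).le
  -- The tangent remainder of `φ` is at most `L‖y - z‖²` in absolute value, so with `2L` those of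
  -- `f₀` and `f₁` both lie between `L‖y - z‖²` and `3L‖y - z‖²`.
  set f₀ : Eucl d → ℝ := fun x => 2 * L * ‖x‖ ^ 2 with hf₀
  set G₀ : Eucl d → Eucl d →L[ℝ] ℝ := fun z => (4 * L) • innerSL ℝ z with hG₀
  set f₁ : Eucl d → ℝ := fun x => φ x + f₀ x with hf₁
  set G₁ : Eucl d → Eucl d →L[ℝ] ℝ := fun z => fderiv ℝ φ z + G₀ z with hG₁
  have hr₀ : ∀ y z, f₀ y - f₀ z - G₀ z (y - z) = 2 * L * ‖y - z‖ ^ 2 := fun y z => by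
    have e1 : G₀ z (y - z) = 4 * L * (inner ℝ z y - ‖z‖ ^ 2) := by
      simp only [hG₀, smul_apply, innerSL_apply_apply, inner_sub_right,
        real_inner_self_eq_norm_sq, smul_eq_mul]
    rw [e1, norm_sub_sq_real, real_inner_comm y z]
    simp only [hf₀]
    ring
  have hr₁ : ∀ y z, f₁ y - f₁ z - G₁ z (y - z) =
      (φ y - φ z - fderiv ℝ φ z (y - z)) + 2 * L * ‖y - z‖ ^ 2 := fun y z => by
    rw [← hr₀ y z]
    simp only [hf₁, hG₁, add_apply]
    ring
  have hq : ∀ y z : Eucl d, 0 ≤ L * ‖y - z‖ ^ 2 := fun y z => by positivity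
  have P₀ := fun (x : Eucl d) (hx : ∃ z ∈ Z, ‖x - z‖ ≤ h) =>
    exists_tangentMax_eq (f := f₀) (G := G₀) hZ (m := L) (M := 3 * L) hL
    (fun y z => by rw [hr₀]; linarith [hq y z]) (fun y z => by rw [hr₀]; linarith [hq y z])
    (by positivity) hx
  have P₁ := fun (x : Eucl d) (hx : ∃ z ∈ Z, ‖x - z‖ ≤ h) =>
    exists_tangentMax_eq (f := f₁) (G := G₁) hZ (m := L) (M := 3 * L) hL
    (fun y z => by rw [hr₁]; linarith [hq y z, abs_le.1 (hφQ y z)])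
    (fun y z => by rw [hr₁]; linarith [hq y z, abs_le.1 (hφQ y z)])
    (by positivity) hx
  have hnear : ∀ x z : Eucl d, L * ‖x - z‖ ^ 2 ≤ 3 * L * h ^ 2 → ‖x - z‖ ≤ 2 * h := by
    intro x z hxz
    have : ‖x - z‖ ^ 2 ≤ 3 * h ^ 2 := le_of_mul_le_mul_left (by linarith) hL
    exact abs_le_of_sq_le_sq' (by nlinarith) (by positivity) |>.2
  set v : Eucl d → ℝ := fun x => tangentMax f₁ G₁ Z hZ x - tangentMax f₀ G₀ Z hZ x with hv
  obtain ⟨K₁, hK₁⟩ := exists_lipschitzWith_tangentMax (f := f₁) (G := G₁) hZ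
  obtain ⟨K₀, hK₀⟩ := exists_lipschitzWith_tangentMax (f := f₀) (G := G₀) hZ
  have hvK : LipschitzWith (K₁ + K₀) v := hK₁.sub hK₀
  -- far from the support of `φ`, the two maxima coincide
  have hv0 : ∀ x ∈ closure Ω, x ∉ Metric.cthickening (2 * h) (tsupport φ) → v x = 0 := by
    intro x hx hxφ
    have hfar : ∀ z, ‖x - z‖ ≤ 2 * h → f₁ z = f₀ z ∧ G₁ z = G₀ z := fun z hz => by
      have hzφ : z ∉ tsupport φ := fun hzφ => hxφ
        (Metric.mem_cthickening_of_dist_le x z _ _ hzφ (by rwa [dist_eq_norm]))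
      constructor
      · simp only [hf₁, image_eq_zero_of_notMem_tsupport hzφ, zero_add]
      · simp only [hG₁, image_eq_zero_of_notMem_tsupport
          (fun hz' => hzφ (tsupport_fderiv_subset ℝ hz')), zero_add]
    obtain ⟨z, hz, e, hxz, -⟩ := P₁ x (hnet x hx)
    obtain ⟨z', hz', e', hxz', -⟩ := P₀ x (hnet x hx)
    refine sub_eq_zero.2 (le_antisymm ?_ ?_)
    · rw [e, (hfar z (hnear _ _ hxz)).1, (hfar z (hnear _ _ hxz)).2]
      exact le_tangentMax hZ hz x
    · rw [e', ← (hfar z' (hnear _ _ hxz')).1, ← (hfar z' (hnear _ _ hxz')).2]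
      exact le_tangentMax hZ hz' x
  have hsub : Metric.cthickening (2 * h) (tsupport φ) ⊆ Ω :=
    (Metric.cthickening_mono hhδ _).trans hδΩ
  have hsupp : tsupport (Ω.indicator v) ⊆ Metric.cthickening (2 * h) (tsupport φ) := by
    refine closure_minimal (fun x hx => ?_) Metric.isClosed_cthickening
    by_contra hxφ
    have hxΩ : x ∈ Ω := mem_of_indicator_ne_zero hx
    exact hx ((indicator_of_mem hxΩ v).trans (hv0 x (subset_closure hxΩ) hxφ))
  -- The net covers only `closure Ω`, so `v` is not controlled outside and is cut off; it vanishes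
  -- on the frontier, which avoids the thickened support.
  refine ⟨K₁ + K₀, Ω.indicator v, image2 (fun a b => G₁ a - G₀ b) Z Z,
    hvK.lipschitzOnWith.indicator_of_frontier fun p hp => hv0 p hp.1 fun hpφ => ?_,
    hφ.compact.isCompact.cthickening.of_isClosed_subset (isClosed_tsupport _) hsupp,
    hsupp.trans hsub, Z.finite_toSet.image2 _ Z.finite_toSet, fun x hx => ?_, ?_⟩
  · rw [hΩ.frontier_eq] at hp
    exact hp.2 (hsub hpφ)
  · obtain ⟨z, hz, -, -, e, -⟩ := P₁ x (hnet x (subset_closure hx))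
    obtain ⟨z', hz', -, -, e', -⟩ := P₀ x (hnet x (subset_closure hx))
    rw [indicator_of_mem hx, Real.norm_eq_abs, abs_le]
    rw [abs_le] at e e'
    simp only [hv]
    simp only [hf₁] at e ⊢
    constructor <;> linarith
  · rw [ae_restrict_iff' hΩ.measurableSet]
    filter_upwards [hK₁.ae_differentiableAt (μ := volume),
      hK₀.ae_differentiableAt (μ := volume)] with x hd₁ hd₀ hx
    obtain ⟨z, hz, -, hxz, -, e⟩ := P₁ x (hnet x (subset_closure hx))
    obtain ⟨z', hz', -, hxz', -, e'⟩ := P₀ x (hnet x (subset_closure hx))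
    have hev : Ω.indicator v =ᶠ[𝓝 x] v := by
      filter_upwards [hΩ.mem_nhds hx] with y hy
      exact indicator_of_mem hy v
    have hfd : fderiv ℝ (Ω.indicator v) x = G₁ z - G₀ z' := by
      rw [hev.fderiv_eq, ← e hd₁, ← e' hd₀]
      exact fderiv_sub hd₁ hd₀
    refine ⟨hfd ▸ mem_image2_of_mem hz hz', ?_⟩
    have hG₀L : ∀ a b, ‖G₀ a - G₀ b‖ = 4 * L * ‖a - b‖ := fun a b => by
      have : G₀ a - G₀ b = (4 * L) • innerSL ℝ (a - b) := by
        ext y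
        simp only [hG₀, sub_apply, smul_apply, innerSL_apply_apply, inner_sub_left, smul_eq_mul]
        ring
      rw [this, norm_smul, innerSL_apply_norm, Real.norm_of_nonneg (by positivity)]
    have e1 : G₁ z - G₀ z' - fderiv ℝ φ x =
        (fderiv ℝ φ z - fderiv ℝ φ x) + (G₀ z - G₀ x) + (G₀ x - G₀ z') := by
      simp only [hG₁]; abel
    rw [hfd, e1]
    refine (norm_add₃_le).trans ?_
    rw [hG₀L, hG₀L]
    have h1 := hφL z x
    have h2 := hnear x z hxz
    have h3 := hnear x z' hxz'
    rw [norm_sub_rev z x] at h1 ⊢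
    have h4 := mul_le_mul_of_nonneg_left h2 hL.le
    have h5 := mul_le_mul_of_nonneg_left h3 hL.le
    linarith

theorem EuclideanSpace.sum_smul_single {ι : Type*} [Fintype ι] [DecidableEq ι]
    (x : EuclideanSpace ℝ ι) : ∑ i, x i • EuclideanSpace.single i (1 : ℝ) = x := by
  ext j
  simp [Finset.sum_apply, Pi.single_apply]

theorem IsTestFun.clm_comp {H : Type*} [NormedAddCommGroup H] [NormedSpace ℝ H] {φ : Eucl d → F}
    (hφ : IsTestFun Ω φ) (A : F →L[ℝ] H) : IsTestFun Ω (fun x => A (φ x)) where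
  smooth := A.contDiff.comp hφ.smooth
  compact := hφ.compact.comp_left (g := A) (map_zero A)
  support := (closure_mono (Function.support_comp_subset (map_zero A) φ)).trans hφ.support

theorem IsTestFun.exists_countable_grad_approx {ι : Type*} [Fintype ι]
    (hΩ : IsOpen Ω) (hΩb : Bornology.IsBounded Ω)
    {φ : Eucl d → EuclideanSpace ℝ ι} (hφ : IsTestFun Ω φ) {ε : ℝ} (hε : 0 < ε) :
    ∃ (K : NNReal) (u : Eucl d → EuclideanSpace ℝ ι) (S : Set (Eucl d →L[ℝ] EuclideanSpace ℝ ι)),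
      LipschitzWith K u ∧ HasCompactSupport u ∧ tsupport u ⊆ Ω ∧ S.Countable ∧
      (∀ x ∈ Ω, ‖u x - φ x‖ ≤ ε) ∧
      ∀ᵐ x ∂volume.restrict Ω, fderiv ℝ u x ∈ S ∧ ‖fderiv ℝ u x - fderiv ℝ φ x‖ ≤ ε := by
  classical
  set e : ι → EuclideanSpace ℝ ι := fun i => EuclideanSpace.single i (1 : ℝ) with he
  have hnorm : ∀ i, ‖e i‖ = 1 := fun i => by simp [he]
  -- The errors of the components add up; the `+ 1` covers an empty index type.
  set η : ℝ := ε / (Fintype.card ι + 1) with hη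
  have hη0 : 0 < η := by positivity
  have hηε : Fintype.card ι * η ≤ ε := by
    rw [hη, mul_div_assoc', div_le_iff₀ (by positivity)]
    nlinarith
  have hφi : ∀ i, IsTestFun Ω fun x => φ x i := fun i =>
    hφ.clm_comp (EuclideanSpace.proj i : EuclideanSpace ℝ ι →L[ℝ] ℝ)
  choose K u S hK hc hs hS h0 h1 using fun i =>
    (hφi i).exists_piecewise_affine_approx hΩ hΩb hη0
  have hφsum : φ = fun x => ∑ i, φ x i • e i := by
    ext1 x
    exact (EuclideanSpace.sum_smul_single (φ x)).symm
  have hsub : tsupport (fun x => ∑ i, u i x • e i) ⊆ ⋃ i, tsupport (u i) := by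
    refine closure_minimal (fun x hx => ?_) (isClosed_iUnion_of_finite fun i => isClosed_tsupport _)
    by_contra h
    simp only [mem_iUnion, not_exists] at h
    exact hx (Finset.sum_eq_zero fun i _ => by
      rw [image_eq_zero_of_notMem_tsupport (h i), zero_smul])
  have hK' : ∀ s : Finset ι, LipschitzWith (∑ i ∈ s, K i) fun x => ∑ i ∈ s, u i x • e i := by
    intro s
    refine LipschitzWith.of_dist_le_mul fun x y => ?_
    rw [dist_eq_norm, ← Finset.sum_sub_distrib, NNReal.coe_sum, Finset.sum_mul]
    refine norm_sum_le_of_le _ fun i _ => ?_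
    rw [← sub_smul, norm_smul, hnorm, mul_one, ← dist_eq_norm]
    exact (hK i).dist_le_mul x y
  refine ⟨∑ i, K i, fun x => ∑ i, u i x • e i,
    (fun A : ι → Eucl d →L[ℝ] ℝ => ∑ i, (A i).smulRight (e i)) '' (Set.pi univ S),
    hK' _, (isCompact_iUnion hc).of_isClosed_subset (isClosed_tsupport _) hsub,
    hsub.trans (iUnion_subset hs), ((Set.Finite.pi' hS).countable.mono
      fun A (hA : A ∈ Set.pi univ S) i => hA i (mem_univ i)).image _, ?_, ?_⟩
  · intro x hx
    rw [← EuclideanSpace.sum_smul_single (φ x), ← Finset.sum_sub_distrib]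
    refine (norm_sum_le_of_le (Finset.univ) (f := fun i => u i x • e i - φ x i • e i)
      (n := fun _ => η) fun i _ => ?_).trans (by simpa using hηε)
    rw [← sub_smul, norm_smul, hnorm, mul_one]
    exact h0 i x hx
  · filter_upwards [ae_all_iff.2 h1, ae_restrict_of_ae (ae_all_iff.2 fun i =>
      (hK i).ae_differentiableAt (μ := volume))] with x hx hd
    have e1 : HasFDerivAt (fun x => ∑ i, u i x • e i) (∑ i, (fderiv ℝ (u i) x).smulRight (e i)) x :=
      HasFDerivAt.fun_sum fun i _ => (hd i).hasFDerivAt.smul_const (e i)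
    have e2 : HasFDerivAt φ (∑ i, (fderiv ℝ (fun y => φ y i) x).smulRight (e i)) x := by
      have : HasFDerivAt (fun x => ∑ i, φ x i • e i)
          (∑ i, (fderiv ℝ (fun y => φ y i) x).smulRight (e i)) x :=
        HasFDerivAt.fun_sum fun i _ =>
          ((hφi i).smooth.differentiable (by simp) x).hasFDerivAt.smul_const (e i)
      rwa [← hφsum] at this
    rw [e1.fderiv, e2.fderiv]
    refine ⟨⟨fun i => fderiv ℝ (u i) x, fun i _ => (hx i).1, rfl⟩, ?_⟩
    rw [← Finset.sum_sub_distrib]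
    refine (norm_sum_le_of_le (Finset.univ) (n := fun _ => η) fun i _ => ?_).trans
      (by simpa using hηε)
    have : (fderiv ℝ (u i) x).smulRight (e i) - (fderiv ℝ (fun y => φ y i) x).smulRight (e i) =
        (fderiv ℝ (u i) x - fderiv ℝ (fun y => φ y i) x).smulRight (e i) := by
      ext1 y
      simp [sub_smul]
    rw [this, ContinuousLinearMap.norm_smulRight_apply, hnorm, mul_one]
    exact (hx i).2

/-! ### The dense subspace of fields with countably many gradients. -/

theorem weakGrad_add [Fact (1 ≤ q)] (v w : SobolevW₀ F Ω q) :
    weakGrad (v + w) =ᵐ[volume.restrict Ω] weakGrad v + weakGrad w :=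
  Lp.coeFn_add _ _

theorem weakGrad_smul [Fact (1 ≤ q)] (c : ℝ) (w : SobolevW₀ F Ω q) :
    weakGrad (c • w) =ᵐ[volume.restrict Ω] c • weakGrad w :=
  Lp.coeFn_smul _ _

theorem weakGrad_zero [Fact (1 ≤ q)] :
    weakGrad (0 : SobolevW₀ F Ω q) =ᵐ[volume.restrict Ω] 0 :=
  Lp.coeFn_zero _ _ _

/-- The elements of `W_0^{1,q}(Ω; F)` whose weak derivative takes only countably many values. -/
def countableGrad (F : Type*) [NormedAddCommGroup F] [NormedSpace ℝ F] (Ω : Set (Eucl d))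
    (q : ℝ≥0∞) [Fact (1 ≤ q)] : Submodule ℝ (SobolevW₀ F Ω q) where
  carrier := {w | ∃ S : Set (Eucl d →L[ℝ] F), S.Countable ∧
    ∀ᵐ x ∂volume.restrict Ω, weakGrad w x ∈ S}
  zero_mem' := ⟨{0}, countable_singleton _, weakGrad_zero⟩
  add_mem' := by
    rintro v w ⟨S, hS, hv⟩ ⟨T, hT, hw⟩
    refine ⟨image2 (· + ·) S T, hS.image2 hT _, ?_⟩
    filter_upwards [hv, hw, weakGrad_add v w] with x h1 h2 h3
    exact h3 ▸ mem_image2_of_mem h1 h2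
  smul_mem' := by
    rintro c w ⟨S, hS, hw⟩
    refine ⟨(fun A => c • A) '' S, hS.image _, ?_⟩
    filter_upwards [hw, weakGrad_smul c w] with x h1 h2
    exact h2 ▸ mem_image_of_mem _ h1

theorem dense_countableGrad {ι : Type*} [Fintype ι] [Fact (1 ≤ q)] (hq_top : q ≠ ⊤)
    (hΩ : IsOpen Ω) (hΩb : Bornology.IsBounded Ω) :
    Dense (countableGrad (EuclideanSpace ℝ ι) Ω q : Set (SobolevW₀ (EuclideanSpace ℝ ι) Ω q)) := by
  have : IsFiniteMeasure (volume.restrict Ω) := isFiniteMeasure_restrict.2 hΩb.measure_lt_top.ne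
  intro w
  rw [Metric.mem_closure_iff]
  intro ε hε
  obtain ⟨t, ⟨φ, hφ, htφ⟩, hwt⟩ := Metric.mem_closure_iff.1 w.2 (ε / 2) (half_pos hε)
  -- Converts uniform errors into `L^q` errors.
  set M : ℝ := (volume.restrict Ω).real univ ^ q.toReal⁻¹
  have hM : 0 ≤ M := by positivity
  obtain ⟨K, u, S, hK, hc, hs, hS, h0, h1⟩ :=
    hφ.exists_countable_grad_approx hΩ hΩb (ε := ε / 2 / (M + 1)) (by positivity)
  obtain ⟨U, hU, hGU⟩ := hK.exists_sobolevW₀ hq_top hΩ hc hs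
  -- Membership in `testFunctions` constrains only the function component; uniqueness of weak
  -- derivatives identifies the gradient.
  have hG : t.1.2 =ᵐ[volume.restrict Ω] fderiv ℝ φ :=
    IsWeakDeriv.ae_eq hΩ (IsWeakDeriv.congr_left t.2 htφ.symm) hφ.isWeakDeriv
      ((Lp.memLp t.1.2).integrable Fact.out) ((hφ.memLp_fderiv (q := 1)).integrable le_rfl)
  have hle : M * (ε / 2 / (M + 1)) ≤ ε / 2 := by
    rw [mul_div_assoc', div_le_iff₀ (by positivity)]
    nlinarith
  refine ⟨U, ⟨S, hS, ?_⟩, ?_⟩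
  · filter_upwards [h1, hGU] with x hx hx'
    exact hx' ▸ hx.1
  · have hd : dist (U.1 : SobolevW (EuclideanSpace ℝ ι) Ω q).1 t.1 ≤ ε / 2 := by
      rw [Prod.dist_eq, dist_eq_norm, dist_eq_norm]
      refine max_le ((Lp.norm_le_of_ae_bound (C := ε / 2 / (M + 1)) (by positivity) ?_).trans hle)
        ((Lp.norm_le_of_ae_bound (C := ε / 2 / (M + 1)) (by positivity) ?_).trans hle)
      · filter_upwards [Lp.coeFn_sub (U.1 : SobolevW (EuclideanSpace ℝ ι) Ω q).1.1 t.1.1, hU, htφ,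
          ae_restrict_mem hΩ.measurableSet] with x e1 e2 e3 hx
        rw [e1, Pi.sub_apply, e2, e3]
        exact h0 x hx
      · filter_upwards [Lp.coeFn_sub (U.1 : SobolevW (EuclideanSpace ℝ ι) Ω q).1.2 t.1.2, hGU, hG,
          h1] with x e1 e2 e3 hx
        rw [weakGrad] at e2
        rw [e1, Pi.sub_apply, e2, e3]
        exact hx.2
    calc dist w U ≤ dist w.1 t + dist t U.1 := dist_triangle w.1 t U.1
      _ < ε / 2 + ε / 2 := by
        refine add_lt_add_of_lt_of_le hwt ?_
        rw [dist_comm]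
        exact hd
      _ = ε := add_halves ε

/-! ### The piecewise quadratic field. -/

/-- The elements of `W_0^{1,q}(Ω; F)` whose weak derivative vanishes on `B`. -/
def gradZeroOn (F : Type*) [NormedAddCommGroup F] [NormedSpace ℝ F] (Ω : Set (Eucl d))
    (q : ℝ≥0∞) [Fact (1 ≤ q)] (B : Set (Eucl d)) : Submodule ℝ (SobolevW₀ F Ω q) where
  carrier := {w | ∀ᵐ x ∂volume.restrict Ω, x ∈ B → weakGrad w x = 0}
  zero_mem' := weakGrad_zero.mono fun x hx _ => hx
  add_mem' := by
    intro v w hv hw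
    filter_upwards [hv, hw, weakGrad_add v w] with x h1 h2 h3 hx
    rw [h3, Pi.add_apply, h1 hx, h2 hx, add_zero]
  smul_mem' := by
    intro c w hw
    filter_upwards [hw, weakGrad_smul c w] with x h1 h2 hx
    rw [h2, Pi.smul_apply, h1 hx, smul_zero]

/-- A subsequence of an `L^q`-convergent sequence of gradients converges a.e. -/
theorem isClosed_gradZeroOn [Fact (1 ≤ q)] (B : Set (Eucl d)) :
    IsClosed (gradZeroOn F Ω q B : Set (SobolevW₀ F Ω q)) := by
  refine IsSeqClosed.isClosed fun w w₀ hw hlim => ?_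
  have hcont : Continuous fun w : SobolevW₀ F Ω q => (w.1 : SobolevW F Ω q).1.2 :=
    continuous_snd.comp (continuous_subtype_val.comp continuous_subtype_val)
  obtain ⟨φ, -, hφ⟩ := (tendstoInMeasure_of_tendsto_Lp
    ((hcont.tendsto w₀).comp hlim)).exists_seq_tendsto_ae
  have hw' : ∀ n, ∀ᵐ x ∂volume.restrict Ω, x ∈ B → weakGrad (w n) x = 0 := hw
  filter_upwards [hφ, ae_all_iff.2 hw'] with x h1 h2 hx
  refine tendsto_nhds_unique h1 (tendsto_const_nhds.congr fun n => ?_)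
  exact (h2 _ hx).symm

theorem tsum_mem_gradZeroOn [Fact (1 ≤ q)] {B : Set (Eucl d)} {ι : Type*}
    {f : ι → SobolevW₀ F Ω q} (hf : ∀ i, f i ∈ gradZeroOn F Ω q B) :
    ∑' i, f i ∈ gradZeroOn F Ω q B := by
  by_cases h : Summable f
  · exact (isClosed_gradZeroOn B).mem_of_tendsto h.hasSum
      (Eventually.of_forall fun s => Submodule.sum_mem _ fun i _ => hf i)
  · rw [tsum_eq_zero_of_not_summable h]
    exact Submodule.zero_mem _

/-- The function `x ↦ (r² - ‖x - y‖²)₊ A` belongs to `W_0^{1,q}(Ω; F)` if the closed ball of centre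
`y` and radius `r` is contained in `Ω`. -/
theorem exists_ball_bump [FiniteDimensional ℝ F] [IsFiniteMeasure (volume.restrict Ω)]
    [Fact (1 ≤ q)] (hq_top : q ≠ ⊤) (hΩ : IsOpen Ω) {y : Eucl d} {r : ℝ} (hr : 0 < r)
    (hB : Metric.closedBall y r ⊆ Ω) (A : F) :
    ∃ W : SobolevW₀ F Ω q, (∀ᵐ x ∂volume.restrict Ω, x ∈ Metric.ball y r →
        weakGrad W x = ((-2 : ℝ) • innerSL ℝ (x - y)).smulRight A) ∧
      W ∈ gradZeroOn F Ω q (Metric.closedBall y r)ᶜ := by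
  set v : Eucl d → F := fun x => (r ^ 2 - ‖x - y‖ ^ 2) • A with hv
  have hcl : closure (Metric.ball y r) ⊆ Metric.closedBall y r := Metric.closure_ball_subset_closedBall
  have hL : LipschitzOnWith (2 * r.toNNReal * ‖A‖₊) v (closure (Metric.ball y r)) := by
    refine LipschitzOnWith.of_dist_le_mul fun a ha b hb => ?_
    have ha' : ‖a - y‖ ≤ r := by simpa [dist_eq_norm] using hcl ha
    have hb' : ‖b - y‖ ≤ r := by simpa [dist_eq_norm] using hcl hb
    have h1 : ‖‖b - y‖ ^ 2 - ‖a - y‖ ^ 2‖ ≤ 2 * r * ‖a - b‖ := by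
      have e : ‖b - y‖ ^ 2 - ‖a - y‖ ^ 2 = (‖b - y‖ + ‖a - y‖) * (‖b - y‖ - ‖a - y‖) := by ring
      rw [e, norm_mul, Real.norm_of_nonneg (by positivity), norm_sub_rev a b]
      have h2 : ‖‖b - y‖ - ‖a - y‖‖ ≤ ‖b - a‖ := by
        simpa using abs_norm_sub_norm_le (b - y) (a - y)
      exact mul_le_mul (by linarith) h2 (norm_nonneg _) (by positivity)
    rw [dist_eq_norm, dist_eq_norm, hv, ← sub_smul, norm_smul, sub_sub_sub_cancel_left]
    calc ‖‖b - y‖ ^ 2 - ‖a - y‖ ^ 2‖ * ‖A‖ ≤ 2 * r * ‖a - b‖ * ‖A‖ := by gcongr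
      _ = _ := by
        rw [NNReal.coe_mul, NNReal.coe_mul, Real.coe_toNNReal r hr.le, coe_nnnorm]
        simp only [NNReal.coe_ofNat]
        ring
  have h0 : ∀ p ∈ frontier (Metric.ball y r), v p = 0 := fun p hp => by
    have : ‖p - y‖ = r := by
      rw [← dist_eq_norm]; exact Metric.mem_sphere.1 (Metric.frontier_ball_subset_sphere hp)
    simp [hv, this]
  have hsupp : tsupport ((Metric.ball y r).indicator v) ⊆ Metric.closedBall y r :=
    closure_minimal (support_indicator_subset.trans Metric.ball_subset_closedBall)
      Metric.isClosed_closedBall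
  obtain ⟨W, -, hW⟩ := (hL.indicator_of_frontier h0).exists_sobolevW₀ (q := q) hq_top hΩ
    ((isCompact_closedBall y r).of_isClosed_subset (isClosed_tsupport _) hsupp) (hsupp.trans hB)
  refine ⟨W, ?_, ?_⟩
  · filter_upwards [hW] with x hx hxB
    have hev : (Metric.ball y r).indicator v =ᶠ[𝓝 x] v := by
      filter_upwards [Metric.isOpen_ball.mem_nhds hxB] with z hz
      exact indicator_of_mem hz v
    rw [hx, hev.fderiv_eq]
    have h1 : HasFDerivAt (fun x => r ^ 2 - ‖x - y‖ ^ 2) ((-2 : ℝ) • innerSL ℝ (x - y)) x := by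
      have := (((hasFDerivAt_id x).sub_const y).norm_sq).const_sub (r ^ 2)
      refine this.congr_fderiv ?_
      ext z
      simp
    exact (h1.smul_const A).fderiv
  · change ∀ᵐ x ∂volume.restrict Ω, _
    filter_upwards [hW] with x hx hxB
    rw [hx]
    exact image_eq_zero_of_notMem_tsupport fun h => hxB (hsupp (tsupport_fderiv_subset ℝ h))

/-- There is an element of `W_0^{1,q}(Ω; F)` whose derivative is, up to a null set, the one of
`x ↦ (a / 2) ‖x - y‖² A` with `a ≠ 0` on each of countably many pieces. -/
theorem exists_piecewise_quadratic [FiniteDimensional ℝ F] [Fact (1 ≤ q)] (hq_top : q ≠ ⊤)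
    (hΩ : IsOpen Ω) (hΩb : Bornology.IsBounded Ω) (A : F) :
    ∃ (ψ : SobolevW₀ F Ω q) (t : Set (Eucl d)) (a : Eucl d → ℝ), t.Countable ∧
      (∀ y, a y ≠ 0) ∧ ∀ᵐ x ∂volume.restrict Ω, ∃ y ∈ t,
        weakGrad ψ x = (a y • innerSL ℝ (x - y)).smulRight A := by
  have : IsFiniteMeasure (volume.restrict Ω) := isFiniteMeasure_restrict.2 hΩb.measure_lt_top.ne
  have : CompleteSpace F := FiniteDimensional.complete ℝ F
  obtain ⟨t, r, ht, htΩ, hr, hcov, hdisj⟩ := Besicovitch.exists_disjoint_closedBall_covering_ae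
    (volume : Measure (Eucl d)) (fun x => {r | Metric.closedBall x r ⊆ Ω}) Ω (fun x hx δ hδ => by
      obtain ⟨ρ, hρ, hρΩ⟩ := Metric.isOpen_iff.1 hΩ x hx
      refine ⟨min ρ δ / 2, ?_, by positivity, (half_lt_self (by positivity)).trans_le
        (min_le_right _ _)⟩
      refine (Metric.closedBall_subset_ball ?_).trans hρΩ
      exact (half_lt_self (by positivity)).trans_le (min_le_left _ _)) (fun _ => 1)
      (fun _ _ => one_pos)
  choose W hW1 hW2 using fun y : t => exists_ball_bump (q := q) hq_top hΩ (hr y y.2).2.1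
    (hr y y.2).1 A
  obtain ⟨c, hc, s, hs, -⟩ := ht.exists_pos_hasSum_le one_pos
  classical
  -- These weights make the series absolutely convergent; the value `1` off `t` keeps `a` nonzero
  -- everywhere.
  set a : Eucl d → ℝ := fun y => if hy : y ∈ t then c y / (1 + ‖W ⟨y, hy⟩‖) else 1 with ha
  have haw : ∀ y : t, a y = c y / (1 + ‖W y‖) := fun y => by simp [ha]
  have hapos : ∀ y, 0 < a y := fun y => by
    simp only [ha]
    split_ifs with hy
    · have := hc y
      positivity
    · exact one_pos
  have hsum : Summable fun y : t => a y • W y := by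
    refine Summable.of_norm_bounded hs.summable fun y => ?_
    rw [norm_smul, Real.norm_of_nonneg (hapos y).le, haw, div_mul_eq_mul_div,
      div_le_iff₀ (by positivity)]
    exact mul_le_mul_of_nonneg_left (by linarith) (hc y).le
  refine ⟨∑' y : t, a y • W y, t, fun y => a y * -2, ht,
    fun y => mul_ne_zero (hapos y).ne' (by norm_num), ?_⟩
  have key : ∀ y : t, ∀ᵐ x ∂volume.restrict Ω, x ∈ Metric.ball (y : Eucl d) (r y) →
      weakGrad (∑' y : t, a y • W y) x =
        ((a y * -2) • innerSL ℝ (x - (y : Eucl d))).smulRight A := fun y => by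
    -- The closed balls are disjoint, so every other bump has zero gradient on this ball, and
    -- closedness passes this to the infinite sum.
    have hrest : ∑' z : t, (if z = y then 0 else a z • W z) ∈
        gradZeroOn F Ω q (Metric.ball (y : Eucl d) (r y)) := by
      refine tsum_mem_gradZeroOn fun z => ?_
      split_ifs with hzy
      · exact Submodule.zero_mem _
      · refine Submodule.smul_mem _ _ ?_
        refine Eventually.mono (show ∀ᵐ x ∂volume.restrict Ω, _ from hW2 z)
          fun x hx hxy => hx fun hxz => ?_
        exact (hdisj z.2 y.2 fun h => hzy (Subtype.ext h)).le_bot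
          ⟨hxz, Metric.ball_subset_closedBall hxy⟩
    rw [hsum.tsum_eq_add_tsum_ite y]
    filter_upwards [hW1 y, hrest, weakGrad_smul (a y) (W y), weakGrad_add (a y • W y)
      (∑' z : t, (if z = y then 0 else a z • W z))] with x h1 h2 h3 h4 hx
    rw [h4, Pi.add_apply, h2 hx, add_zero, h3, Pi.smul_apply, h1 hx]
    ext z
    simp [mul_assoc, smul_smul]
  have : Countable t := ht
  have hsph : ∀ y : t, ∀ᵐ x ∂volume.restrict Ω, x ∉ Metric.sphere (y : Eucl d) (r y) := fun y =>
    ae_restrict_of_ae (measure_eq_zero_iff_ae_notMem.1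
      (Measure.addHaar_sphere_of_ne_zero volume _ (hr y y.2).2.1.ne'))
  have hcov' : ∀ᵐ x ∂volume.restrict Ω, x ∈ ⋃ y ∈ t, Metric.closedBall y (r y) := by
    rw [ae_restrict_iff' hΩ.measurableSet]
    filter_upwards [measure_eq_zero_iff_ae_notMem.1 hcov] with x hx hxΩ
    exact by_contra fun h => hx ⟨hxΩ, h⟩
  filter_upwards [ae_all_iff.2 key, ae_all_iff.2 hsph, hcov'] with x h1 h2 h3
  obtain ⟨y, hy, hxy⟩ := mem_iUnion₂.1 h3
  refine ⟨y, hy, h1 ⟨y, hy⟩ ?_⟩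
  exact lt_of_le_of_ne hxy (h2 ⟨y, hy⟩)

/-! ### Non-degeneracy of the divergence. -/

theorem volume_preimage_add_smul_sub {N : Set (Eucl d)} (hN : volume N = 0) (b y : Eucl d)
    {a : ℝ} (ha : a ≠ 0) : volume ((fun x => b + a • (x - y)) ⁻¹' N) = 0 := by
  have : (fun x : Eucl d => b + a • (x - y)) ⁻¹' N =
      (fun x => x + -y) ⁻¹' ((fun x => a • x) ⁻¹' ((fun x => b + x) ⁻¹' N)) := by
    ext x
    simp [sub_eq_add_neg]
  rw [this, measure_preimage_add_right, Measure.addHaar_preimage_smul _ ha, measure_preimage_add,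
    hN, mul_zero]

/-- A map which on countably many pieces is a similarity is non-degenerate. -/
theorem nondegenerate_of_countable_similarity (hΩ : MeasurableSet Ω) {T : Eucl d → Eucl d}
    {S t : Set (Eucl d)} {a : Eucl d → ℝ} (hS : S.Countable) (ht : t.Countable)
    (ha : ∀ y, a y ≠ 0)
    (hT : ∀ᵐ x ∂volume.restrict Ω, ∃ b ∈ S, ∃ y ∈ t, T x = b + a y • (x - y)) :
    Nondegenerate Ω T := by
  intro N hN
  have hnull : ∀ᵐ x : Eucl d, x ∉ ⋃ b ∈ S, ⋃ y ∈ t, (fun x => b + a y • (x - y)) ⁻¹' N :=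
    measure_eq_zero_iff_ae_notMem.1 <| (measure_biUnion_null_iff hS).2 fun b _ =>
      (measure_biUnion_null_iff ht).2 fun y _ => volume_preimage_add_smul_sub hN b y (ha y)
  rw [measure_eq_zero_iff_ae_notMem]
  filter_upwards [(ae_restrict_iff' hΩ).1 hT, hnull] with x h1 h2 hx
  obtain ⟨b, hb, y, hy, e⟩ := h1 hx.1
  exact h2 (mem_iUnion₂.2 ⟨b, hb, mem_iUnion₂.2 ⟨y, hy, by
    rw [mem_preimage, ← e]; exact hx.2⟩⟩)

/-- The divergence of a matrix field with derivative `A`. -/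
noncomputable def divMap (A : Eucl d →L[ℝ] Mat d) : Eucl d :=
  WithLp.toLp 2 fun i => ∑ j, A (EuclideanSpace.single j 1) (i, j)

theorem divMap_add_smul (A B : Eucl d →L[ℝ] Mat d) (c : ℝ) :
    divMap (A + c • B) = divMap A + c • divMap B := by
  ext i
  simp [divMap, Finset.sum_add_distrib, Finset.mul_sum]

/-- The reason for taking `A = Id` in the bumps: the divergence of `g • Id` is `∇g`. -/
theorem divMap_smulRight_one (l : Eucl d) :
    divMap ((innerSL ℝ l).smulRight (WithLp.toLp 2 fun p => if p.1 = p.2 then (1 : ℝ) else 0)) =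
      l := by
  ext i
  simp [divMap, EuclideanSpace.inner_single_right]

theorem nondegenerate_divergence_add_smul [Fact (1 ≤ q)] (hΩ : MeasurableSet Ω)
    {v ψ : SobolevW₀ (Mat d) Ω q} (hv : v ∈ countableGrad (Mat d) Ω q) {t : Set (Eucl d)}
    {a : Eucl d → ℝ} (ht : t.Countable) (ha : ∀ y, a y ≠ 0)
    (hψ : ∀ᵐ x ∂volume.restrict Ω, ∃ y ∈ t, weakGrad ψ x =
      (a y • innerSL ℝ (x - y)).smulRight
        (WithLp.toLp 2 fun p : Fin d × Fin d => if p.1 = p.2 then (1 : ℝ) else 0))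
    {c : ℝ} (hc : c ≠ 0) : Nondegenerate Ω (divergence (v + c • ψ)) := by
  obtain ⟨S, hS, hvS⟩ := hv
  refine nondegenerate_of_countable_similarity hΩ (a := fun y => c * a y)
    (hS.image divMap) ht (fun y => mul_ne_zero hc (ha y)) ?_
  filter_upwards [hvS, hψ, weakGrad_add v (c • ψ), weakGrad_smul c ψ] with x h1 h2 h3 h4
  obtain ⟨y, hy, e⟩ := h2
  refine ⟨_, mem_image_of_mem _ h1, y, hy, ?_⟩
  change divMap (weakGrad (v + c • ψ) x) = _
  rw [h3, Pi.add_apply, h4, Pi.smul_apply, divMap_add_smul, e, ← smul_smul]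
  congr 2
  rw [← divMap_smulRight_one (a y • (x - y)), map_smul]

/-! ### The exhausting sequence and the conclusion. -/

open Pointwise in
/-- An increasing sequence of closed convex sets of finite dimension with dense union, all of whose
elements belong to `V + (0, ∞) ψ`, where `V` is a given dense subspace. -/
theorem exists_closed_convex_exhaustion {X : Type*} [NormedAddCommGroup X] [NormedSpace ℝ X]
    [SecondCountableTopology X] {V : Submodule ℝ X} (hV : Dense (V : Set X)) (ψ : X) :
    ∃ Q : ℕ+ → Set X, (∀ n, FiniteDimensional ℝ (Submodule.span ℝ (Q n))) ∧
      (∀ n, (Q n).Nonempty) ∧ (∀ n, IsClosed (Q n)) ∧ (∀ n, Convex ℝ (Q n)) ∧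
      (∀ n, ∀ w ∈ Q n, ∃ v ∈ V, ∃ c : ℝ, 0 < c ∧ w = v + c • ψ) ∧
      Dense (⋃ n, Q n) ∧ ∀ i j, i ≤ j → Q i ⊆ Q j := by
  obtain ⟨v, hv⟩ := TopologicalSpace.exists_dense_seq V
  set E : ℕ+ → Submodule ℝ X := fun n =>
    Submodule.span ℝ ((fun k => (v k : X)) '' Set.Iic (n : ℕ)) with hE
  -- The lower end keeps the coefficient of `ψ` positive, yet tends to zero for density; the upper
  -- end makes the set compact.
  set I : ℕ+ → Set X := fun n => (fun c : ℝ => c • ψ) '' Set.Icc (1 / (n : ℝ)) 1 with hI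
  have hn0 : ∀ n : ℕ+, (0 : ℝ) < n := fun n => by exact_mod_cast n.pos
  have hn1 : ∀ n : ℕ+, 1 / (n : ℝ) ≤ 1 := fun n => by
    rw [div_le_one (hn0 n)]; exact_mod_cast (one_le : 1 ≤ n)
  have hEfin : ∀ n, FiniteDimensional ℝ (E n) := fun n =>
    FiniteDimensional.span_of_finite ℝ ((Set.finite_Iic _).image _)
  have hEV : ∀ n, E n ≤ V := fun n => Submodule.span_le.2 <| by
    rintro _ ⟨k, -, rfl⟩
    exact (v k).2
  have hadd : ∀ n, (E n : Set X) + I n = {w | ∃ e ∈ E n, ∃ c ∈ Set.Icc (1 / (n : ℝ)) 1,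
      w = e + c • ψ} := fun n => by
    ext w
    constructor
    · rintro ⟨e, he, _, ⟨c, hc, rfl⟩, rfl⟩
      exact ⟨e, he, c, hc, rfl⟩
    · rintro ⟨e, he, c, hc, rfl⟩
      exact ⟨e, he, _, ⟨c, hc, rfl⟩, rfl⟩
  refine ⟨fun n => (E n : Set X) + I n, fun n => ?_, fun n => ?_, fun n => ?_, fun n => ?_,
    fun n w hw => ?_, ?_, fun i j hij => ?_⟩
  · have hle : Submodule.span ℝ ((E n : Set X) + I n) ≤ E n ⊔ Submodule.span ℝ {ψ} := by
      refine Submodule.span_le.2 ?_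
      rintro _ ⟨e, he, _, ⟨c, -, rfl⟩, rfl⟩
      exact Submodule.add_mem_sup he
        (Submodule.smul_mem _ _ (Submodule.mem_span_singleton_self ψ))
    have := hEfin n
    exact Submodule.finiteDimensional_of_le hle
  · exact ⟨0 + (1 : ℝ) • ψ, (hadd n).symm.subset
      ⟨0, Submodule.zero_mem _, 1, ⟨hn1 n, le_rfl⟩, rfl⟩⟩
  · have := hEfin n
    exact (Submodule.closed_of_finiteDimensional (E n)).add_right_of_isCompact
      (isCompact_Icc.image (continuous_id.smul continuous_const))
  · refine (E n).convex.add ?_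
    exact (convex_Icc _ _).is_linear_image (f := fun c : ℝ => c • ψ)
      ⟨fun a b => add_smul a b ψ, fun a b => smul_assoc a b ψ⟩
  · obtain ⟨e, he, c, hc, rfl⟩ := (hadd n).subset hw
    exact ⟨e, hEV n he, c, (div_pos one_pos (hn0 n)).trans_le hc.1, rfl⟩
  · have hdense : Dense (range fun k => (v k : X)) := by
      have := hV.denseRange_val.comp hv continuous_subtype_val
      exact this
    intro x
    rw [Metric.mem_closure_iff]
    intro ε hε
    obtain ⟨_, ⟨k, rfl⟩, hk⟩ := Metric.mem_closure_iff.1 (hdense x) (ε / 2) (half_pos hε)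
    obtain ⟨m, hm⟩ := exists_nat_gt (‖ψ‖ / (ε / 2))
    -- `n ≥ k` puts `v k` in `E n`, and `n ≥ m` makes `(1/n) • ψ` shorter than `ε / 2`.
    set n : ℕ+ := ⟨max k m + 1, Nat.succ_pos _⟩ with hn
    have hnm : (m : ℝ) ≤ n := by
      have : m ≤ (n : ℕ) := (le_max_right k m).trans (Nat.le_succ _)
      exact_mod_cast this
    refine ⟨v k + (1 / (n : ℝ)) • ψ, mem_iUnion.2 ⟨n, ?_⟩, ?_⟩
    · rw [hadd]
      refine ⟨v k, Submodule.subset_span ⟨k, ?_, rfl⟩, _, ⟨le_rfl, hn1 n⟩, rfl⟩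
      exact (le_max_left k m).trans (Nat.le_succ _)
    · have h1 : ‖(1 / (n : ℝ)) • ψ‖ < ε / 2 := by
        rw [norm_smul, Real.norm_of_nonneg (by have := hn0 n; positivity), one_div_mul_eq_div,
          div_lt_iff₀ (hn0 n)]
        rw [div_lt_iff₀ (half_pos hε)] at hm
        nlinarith
      calc dist x (v k + (1 / (n : ℝ)) • ψ)
          ≤ dist x (v k) + dist (v k : X) (v k + (1 / (n : ℝ)) • ψ) := dist_triangle _ _ _
        _ < ε / 2 + ε / 2 := add_lt_add hk (by rwa [dist_self_add_right])
        _ = ε := add_halves ε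
  · refine Set.add_subset_add (Submodule.span_mono (image_mono (Iic_subset_Iic.2 ?_)))
      (image_mono (Icc_subset_Icc_left ?_))
    · exact_mod_cast hij
    · have : (i : ℝ) ≤ j := by exact_mod_cast hij
      exact one_div_le_one_div_of_le (hn0 i) this

/-- Separability, inherited from `L^q` with `q < ⊤`, supplies the dense sequence in `V`. -/
instance [Fact (1 ≤ q)] [Fact (q ≠ ⊤)] [FiniteDimensional ℝ F] :
    SecondCountableTopology (SobolevW₀ F Ω q) := by
  have : ProperSpace F := FiniteDimensional.proper_real F
  have : SecondCountableTopology (Lp F q (volume.restrict Ω)) := Lp.SecondCountableTopology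
  have : SecondCountableTopology (Lp (Eucl d →L[ℝ] F) q (volume.restrict Ω)) :=
    Lp.SecondCountableTopology
  have : SecondCountableTopology (SobolevW F Ω q) :=
    TopologicalSpace.Subtype.secondCountableTopology _
  exact TopologicalSpace.Subtype.secondCountableTopology
    ((testFunctions F Ω q).topologicalClosure : Set (SobolevW F Ω q))

theorem lemma2p5 (d : ℕ) (Ω : Set (Eucl d)) (hΩ_open : IsOpen Ω)
    (hΩ_bdd : Bornology.IsBounded Ω) (hΩ_conv : Convex ℝ Ω)
    (q : ℝ≥0∞) [Fact (1 ≤ q)] (hq_one : 1 < q) (hq_top : q < ⊤)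
    (hA0 : AssumptionA0 Ω) :
    ∃ Q : ℕ+ → Set (SobolevW₀ (Mat d) Ω q), HypothesisH2 Ω q Q := by
  have : Fact (q ≠ ⊤) := ⟨hq_top.ne⟩
  obtain ⟨ψ, t, a, ht, ha, hψ⟩ := exists_piecewise_quadratic (q := q) hq_top.ne hΩ_open hΩ_bdd
    (WithLp.toLp 2 fun p : Fin d × Fin d => if p.1 = p.2 then (1 : ℝ) else 0)
  obtain ⟨Q, h1, h2, h3, h4, h5, h6, h7⟩ := exists_closed_convex_exhaustion
    (dense_countableGrad (ι := Fin d × Fin d) (q := q) hq_top.ne hΩ_open hΩ_bdd) ψ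
  refine ⟨Q, h1, h2, h3, h4, fun n φ hφ => ?_, h6, h7⟩
  obtain ⟨v, hv, c, hc, rfl⟩ := h5 n φ hφ
  exact nondegenerate_divergence_add_smul hΩ_open.measurableSet hv ht ha hψ hc.ne'
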